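/- Let $T>0$, let $(\Omega,\mathcal F,(\mathcal F_t)_{t\in[0,T]},P)$ be a filtered probability space satisfying the usual conditions, and let $B$ be a one-dimensional $(\mathcal F_t)$-Brownian motion on $[0,T]$. Let $a_1,a_2,\rho_1,\rho_2>0$, put $a=a_1\mathbf 1_{\{x\le 0\}}+a_2\mathbf 1_{\{x>0\}}$, $\rho=\rho_1\mathbf 1_{\{x\le 0\}}+\rho_2\mathbf 1_{\{x>0\}}$, and let $\mathcal A=\frac1{2\rho}\frac{d}{dx}\big(a\rho\frac{d}{dx}\big)$ with derivatives in the distributional sense. For $t>0$ and $x,z\in\mathbb R$ let $$G(t,x,z)=\frac1{\sqrt{2\pi t}}\Big(\frac{\mathbf 1_{\{z\le0\}}}{\sqrt{a_1}}+\frac{\mathbf 1_{\{z>0\}}}{\sqrt{a_2}}\Big)\Big\{e^{-\frac{(h(x)-h(z))^2}{2t}}+\lambda\,\mathrm{sign}(z)\,e^{-\frac{(|h(x)|+|h(z)|)^2}{2t}}\Big\},$$ where $h(z)=\frac{z}{\sqrt{a_1}}\mathbf 1_{\{z\le 0\}}+\frac{z}{\sqrt{a_2}}\mathbf 1_{\{z>0\}}$,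 $\lambda=\frac{\rho_2\sqrt{a_2}-\rho_1\sqrt{a_1}}{\rho_2\sqrt{a_2}+\rho_1\sqrt{a_1}}$, and $\mathrm{sign}(z)=1$ for $z>0$, $\mathrm{sign}(z)=-1$ for $z\le 0$; put $G(t,x,z)=0$ for $t\le 0$. Let $\sigma_0\in\mathbb R$ and let $\xi:\mathbb R\to\mathbb R$ be measurable and bounded. A mild solution of $$dY(t,x)=\mathcal A Y(t,x)\,dt+\sigma_0\,dB(t),\quad (t,x)\in[0,T]\times\mathbb R,\qquad Y(0,x)=\xi(x),$$ is a family $Y(t,x)$, $(t,x)\in[0,T]\times\mathbb R$, of real random variables such that $Y(t,x)$ is $\mathcal F_t$-measurable, $Y(0,x)=\xi(x)$ a.s., and, for $0<t\le T$ and $x\in\mathbb R$, the following integrals exist (the stochastic one as an Itô integral of a square-integrable integrand) and, almost surely, $$Y(t,x)=\int_{\mathbb R}G(t,x,z)\,\xi(z)\,dz+\int_0^t\Big(\int_{\mathbb R}G(t-s,x,z)\,\sigma_0\,dz\Big)dB_s .$$ Then the mild solution is well defined: $G$ is a fundamental solution of $\partial_tY=\mathcal AY$ (for each $z$ it satisfies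 $\partial_tG(t,\cdot,z)=\mathcal A G(t,\cdot,z)$ for $t>0$, and $\int_{\mathbb R} G(t,x,z)f(z)\,dz\to f(x)$ as $t\downarrow0$ for all $x\in\mathbb R$ and all bounded continuous $f$), a mild solution exists, and any two mild solutions are modifications of each other. Moreover, every mild solution satisfies $$\sup_{t\in[0,T]}\ \sup_{x\in\mathbb R}\ \mathbb E\big[|Y(t,x)|^2\big]<\infty .$$ -/

import Mathlib

open MeasureTheory ProbabilityTheory Filter Topology
open scoped ENNReal

/-! ### The two-phase divergence-form operator -/

/-- The two-valued function `c₁ 1_{x ≤ 0} + c₂ 1_{x > 0}`. -/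
noncomputable def twoPhase (c₁ c₂ x : ℝ) : ℝ := if x ≤ 0 then c₁ else c₂

/-- `g` is the distributional derivative of `f` on the real line. -/
def HasWeakDerivative (f g : ℝ → ℝ) : Prop :=
  LocallyIntegrable f ∧ LocallyIntegrable g ∧
    ∀ φ : ℝ → ℝ, ContDiff ℝ (⊤ : ℕ∞) φ → HasCompactSupport φ →
      ∫ x, f x * deriv φ x = -∫ x, g x * φ x

/-- `w = 𝒜 u`, where `𝒜 = (1 / (2 ρ)) d/dx (a ρ d/dx)`, `a = a₁ 1_{x ≤ 0} + a₂ 1_{x > 0}`,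
`ρ = ρ₁ 1_{x ≤ 0} + ρ₂ 1_{x > 0}`, and `d/dx` is the distributional derivative. -/
def IsDivergenceImage (a₁ a₂ ρ₁ ρ₂ : ℝ) (u w : ℝ → ℝ) : Prop :=
  ∃ g : ℝ → ℝ, HasWeakDerivative u g ∧
    HasWeakDerivative (fun x => twoPhase a₁ a₂ x * twoPhase ρ₁ ρ₂ x * g x)
      (fun x => 2 * twoPhase ρ₁ ρ₂ x * w x)

/-- `K t x z` is a fundamental solution of `∂ₜ Y = 𝒜 Y`: for every source point `z` it solves the
equation for `t > 0`, and `∫ K t x z f z dz → f x` as `t ↓ 0` for all bounded continuous `f`. -/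
structure IsFundamentalSolution (a₁ a₂ ρ₁ ρ₂ : ℝ) (K : ℝ → ℝ → ℝ → ℝ) : Prop where
  integrable : ∀ t x : ℝ, 0 < t → Integrable (fun z => K t x z)
  differentiable : ∀ t x z : ℝ, 0 < t → DifferentiableAt ℝ (fun s => K s x z) t
  equation : ∀ t z : ℝ, 0 < t → IsDivergenceImage a₁ a₂ ρ₁ ρ₂ (fun x => K t x z)
    (fun x => deriv (fun s => K s x z) t)
  initial : ∀ f : ℝ → ℝ, Continuous f → (∃ M : ℝ, ∀ x, |f x| ≤ M) →
    ∀ x, Tendsto (fun t => ∫ z, K t x z * f z) (𝓝[>] 0) (𝓝 (f x))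

/-- `λ = (ρ₂ √a₂ - ρ₁ √a₁) / (ρ₂ √a₂ + ρ₁ √a₁)`. -/
noncomputable def skewness (a₁ a₂ ρ₁ ρ₂ : ℝ) : ℝ :=
  (ρ₂ * √a₂ - ρ₁ * √a₁) / (ρ₂ * √a₂ + ρ₁ * √a₁)

/-- `h z = z / √a₁` for `z ≤ 0` and `h z = z / √a₂` for `z > 0`. -/
noncomputable def rescale (a₁ a₂ z : ℝ) : ℝ := z / √(twoPhase a₁ a₂ z)

/-- The explicit fundamental solution `G t x z` of `∂ₜ Y = 𝒜 Y`, extended by `0` to `t ≤ 0`. -/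
noncomputable def fundSol (a₁ a₂ ρ₁ ρ₂ t x z : ℝ) : ℝ :=
  if 0 < t then
    1 / √(2 * Real.pi * t) * (1 / √(twoPhase a₁ a₂ z)) *
      (Real.exp (-(rescale a₁ a₂ x - rescale a₁ a₂ z) ^ 2 / (2 * t)) +
        skewness a₁ a₂ ρ₁ ρ₂ * twoPhase (-1) 1 z *
          Real.exp (-(|rescale a₁ a₂ x| + |rescale a₁ a₂ z|) ^ 2 / (2 * t)))
  else 0

/-! ### Filtered probability space, Brownian motion and the Itô integral on `[0,T]` -/

/-- Lebesgue measure on the time interval `[0,T]`. -/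
noncomputable def timeMeasure (T : ℝ) : Measure (Set.Icc (0 : ℝ) T) :=
  Measure.comap Subtype.val volume

section Stochastic

variable {Ω : Type*} {mΩ : MeasurableSpace Ω} {T : ℝ}

/-- The usual conditions: the filtration is right-continuous and contains all null sets. -/
structure UsualConditions (𝓕 : Filtration (Set.Icc (0 : ℝ) T) mΩ) (P : Measure Ω) : Prop where
  rightContinuous : 𝓕.IsRightContinuous
  complete : ∀ (t : Set.Icc (0 : ℝ) T) (A : Set Ω), P A = 0 → MeasurableSet[𝓕 t] A

/-- `B` is a standard one-dimensional Brownian motion on `[0,T]` relative to `𝓕`. -/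
structure IsFBrownianMotion (𝓕 : Filtration (Set.Icc (0 : ℝ) T) mΩ) (P : Measure Ω)
    (B : Set.Icc (0 : ℝ) T → Ω → ℝ) : Prop where
  adapted : ∀ t, StronglyMeasurable[𝓕 t] (B t)
  zero : ∀ t : Set.Icc (0 : ℝ) T, (t : ℝ) = 0 → B t =ᵐ[P] 0
  law : ∀ s t, s ≤ t →
    HasLaw (fun ω => B t ω - B s ω) (gaussianReal 0 (Real.toNNReal ((t : ℝ) - s))) P
  indep : ∀ s t, s ≤ t →
    Indep (MeasurableSpace.comap (fun ω => B t ω - B s ω) inferInstance) (𝓕 s) P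
  continuous : ∀ᵐ ω ∂P, Continuous (fun t => B t ω)

/-- An elementary process: a finite sum `∑ i, coef i · 1_{(left i, right i]}` in which `coef i` is
bounded and measurable at time `left i`. -/
structure ElementaryProcess (𝓕 : Filtration (Set.Icc (0 : ℝ) T) mΩ) where
  n : ℕ
  left : Fin n → Set.Icc (0 : ℝ) T
  right : Fin n → Set.Icc (0 : ℝ) T
  left_le_right : ∀ i, left i ≤ right i
  coef : Fin n → Ω → ℝ
  coef_meas : ∀ i, StronglyMeasurable[𝓕 (left i)] (coef i)
  coef_bdd : ∀ i, ∃ C : ℝ, ∀ ω, |coef i ω| ≤ C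

/-- The value of an elementary process at time `s`. -/
noncomputable def ElementaryProcess.val {𝓕 : Filtration (Set.Icc (0 : ℝ) T) mΩ}
    (S : ElementaryProcess 𝓕) (s : Set.Icc (0 : ℝ) T) (ω : Ω) : ℝ :=
  ∑ i, (Set.Ioc (S.left i) (S.right i)).indicator (fun _ => S.coef i ω) s

/-- The stochastic integral of an elementary process over `[0,t]`. -/
noncomputable def ElementaryProcess.integral {𝓕 : Filtration (Set.Icc (0 : ℝ) T) mΩ}
    (S : ElementaryProcess 𝓕) (B : Set.Icc (0 : ℝ) T → Ω → ℝ) (t : Set.Icc (0 : ℝ) T)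
    (ω : Ω) : ℝ :=
  ∑ i, S.coef i ω * (B (min (S.right i) t) ω - B (min (S.left i) t) ω)

/-- `I` is (a version of) the Itô integral `∫₀ᵗ H s dB s` of the progressively measurable process
`H` with `E ∫₀ᵗ |H s|² ds < ∞`: the `L²` limit of the integrals of elementary processes that
approximate `H` in `L²([0,t] × Ω)`. -/
structure IsItoIntegral (𝓕 : Filtration (Set.Icc (0 : ℝ) T) mΩ) (P : Measure Ω)
    (B : Set.Icc (0 : ℝ) T → Ω → ℝ) (t : Set.Icc (0 : ℝ) T)
    (H : Set.Icc (0 : ℝ) T → Ω → ℝ) (I : Ω → ℝ) : Prop where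
  progressive : IsStronglyProgressive 𝓕 H
  square_integrable : (∫⁻ ω, ∫⁻ s in Set.Iic t, ‖H s ω‖ₑ ^ 2 ∂(timeMeasure T) ∂P) < ∞
  memLp : MemLp I 2 P
  approx : ∃ S : ℕ → ElementaryProcess 𝓕,
    Tendsto (fun k => ∫⁻ ω, ∫⁻ s in Set.Iic t, ‖(S k).val s ω - H s ω‖ₑ ^ 2 ∂(timeMeasure T) ∂P)
      atTop (𝓝 0) ∧
    Tendsto (fun k => ∫⁻ ω, ‖(S k).integral B t ω - I ω‖ₑ ^ 2 ∂P) atTop (𝓝 0)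

/-- `Y` is a mild solution of
`dY(t,x) = 𝒜 Y(t,x) dt + b(t,x,Y(t,x)) dt + σ(t,x,Y(t,x)) dB(t)`, `Y(0,x) = ξ(x)`, on `[0,T] × ℝ`;
`K` is the fundamental solution of `∂ₜ Y = 𝒜 Y`. The mild formula is imposed for `t > 0`, and
`Y(0,x) = ξ(x)` at `t = 0`, where `K t x z dz` degenerates to the Dirac mass at `x`. -/
structure IsMildSolution (K : ℝ → ℝ → ℝ → ℝ) (𝓕 : Filtration (Set.Icc (0 : ℝ) T) mΩ)
    (P : Measure Ω) (B : Set.Icc (0 : ℝ) T → Ω → ℝ)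
    (b σ : Set.Icc (0 : ℝ) T → ℝ → ℝ → Ω → ℝ) (ξ : ℝ → ℝ)
    (Y : Set.Icc (0 : ℝ) T → ℝ → Ω → ℝ) : Prop where
  adapted : ∀ t x, StronglyMeasurable[𝓕 t] (Y t x)
  initial : ∀ (t : Set.Icc (0 : ℝ) T) (x : ℝ), (t : ℝ) = 0 → ∀ᵐ ω ∂P, Y t x ω = ξ x
  integrable_initial : ∀ (t : Set.Icc (0 : ℝ) T) (x : ℝ), 0 < (t : ℝ) → Integrable (fun z => K t x z * ξ z)
  integrable_drift : ∀ (t : Set.Icc (0 : ℝ) T) (x : ℝ), 0 < (t : ℝ) → ∀ᵐ ω ∂P,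
    Integrable (fun p : Set.Icc (0 : ℝ) T × ℝ => K (t - p.1) x p.2 * b p.1 p.2 (Y p.1 p.2 ω) ω)
      (((timeMeasure T).restrict (Set.Iic t)).prod volume)
  integrable_noise : ∀ (t : Set.Icc (0 : ℝ) T) (x : ℝ), 0 < (t : ℝ) → ∀ᵐ s : Set.Icc (0 : ℝ) T ∂((timeMeasure T).restrict (Set.Iic t)), ∀ᵐ ω ∂P,
    Integrable (fun z => K (t - s) x z * σ s z (Y s z ω) ω)
  mild : ∀ (t : Set.Icc (0 : ℝ) T) (x : ℝ), 0 < (t : ℝ) → ∃ I : Ω → ℝ,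
    IsItoIntegral 𝓕 P B t (fun s ω => ∫ z, K (t - s) x z * σ s z (Y s z ω) ω) I ∧
    ∀ᵐ ω ∂P, Y t x ω = (∫ z, K t x z * ξ z) +
      (∫ s in Set.Iic t, (∫ z, K (t - s) x z * b s z (Y s z ω) ω) ∂(timeMeasure T)) + I ω

end Stochastic

/-! ### Weak derivatives of functions glued at the origin -/

/-! In the coordinate `y = h z` the measure `G t x z dz` becomes the skew Brownian kernel `q_t(u -
y) + λ sign(y) q_t(|u| + |y|)` times `dy`, where `u = h x` and `q` is the Gaussian heat kernel. The
second term is odd in `y` off the origin, so the total mass is one. It is dominated by the first,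
because `|λ| ≤ 1` and `|u - y| ≤ |u| + |y|`, so `G ≥ 0`.

On each side of `x = 0` the function `|h x|` is linear, so `G` coincides there with a smooth
function solving `∂ₜ = (a/2) ∂ₓ²`. Two such branches glue to a distributional solution when the
values and the fluxes `a ρ ∂ₓ G` match at the interface (`hasWeakDerivative_piecewise`). Matching of
fluxes is the identity `√a₁ ρ₁ (1 + λ) = √a₂ ρ₂ (1 - λ)`, which determines `λ`
(`flux_branchDeriv_zero`). The initial condition follows from the substitution `y = √t v` and
dominated convergence, the odd term disappearing in the limit.

The noise coefficient is constant in space, so mass one reduces the stochastic convolution to the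
Itô integral of a constant, namely `σ₀ (B_t - B_0)`. The Itô integral is only specified as an `L²`
limit along some approximating sequence; the isometry for elementary integrands (`ito_isometry`)
shows that the limit does not depend on the sequence. Hence for `t > 0` every mild solution is
almost surely `∫ G ξ + σ₀ (B_t - B_0)`. Existence, uniqueness up to modification and the bound `2
(M² + σ₀² T)` are all read off from this formula. -/

theorem piecewise_eq_indicator_add (U V : ℝ → ℝ) :
    (fun x => if x ≤ 0 then U x else V x) =
      (Set.Iic (0 : ℝ)).indicator U + (Set.Ioi (0 : ℝ)).indicator V := by
  funext x
  by_cases h : x ≤ 0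
  · simp [h]
  · simp [h, not_le.mp h]

theorem locallyIntegrable_piecewise {U V : ℝ → ℝ} (hU : Continuous U) (hV : Continuous V) :
    LocallyIntegrable (fun x => if x ≤ 0 then U x else V x) := by
  rw [piecewise_eq_indicator_add]
  exact (hU.locallyIntegrable.indicator measurableSet_Iic).add
    (hV.locallyIntegrable.indicator measurableSet_Ioi)

theorem integral_piecewise_mul {U V φ : ℝ → ℝ} (hU : Continuous U) (hV : Continuous V)
    (hφ : Continuous φ) (hc : HasCompactSupport φ) :
    ∫ x, (if x ≤ 0 then U x else V x) * φ x =
      (∫ x in Set.Iic 0, U x * φ x) + ∫ x in Set.Ioi 0, V x * φ x := by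
  have hUi : Integrable (fun x => U x * φ x) :=
    (hU.mul hφ).integrable_of_hasCompactSupport hc.mul_left
  have hVi : Integrable (fun x => V x * φ x) :=
    (hV.mul hφ).integrable_of_hasCompactSupport hc.mul_left
  have h := piecewise_eq_indicator_add (fun x => U x * φ x) (fun x => V x * φ x)
  have h' : (fun x => (if x ≤ 0 then U x else V x) * φ x) =
      (Set.Iic (0 : ℝ)).indicator (fun x => U x * φ x) +
        (Set.Ioi (0 : ℝ)).indicator (fun x => V x * φ x) := by
    rw [← h]; funext x; split_ifs <;> rfl
  rw [h', integral_add' (hUi.indicator measurableSet_Iic) (hVi.indicator measurableSet_Ioi),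
    integral_indicator measurableSet_Iic, integral_indicator measurableSet_Ioi]

/-- Integration by parts on each half-line. The test function kills the boundary terms at infinity,
and those at the origin, `U 0 * φ 0` and `-V 0 * φ 0`, cancel because the branches agree there. -/
theorem hasWeakDerivative_piecewise {U V U' V' : ℝ → ℝ} (hU : ∀ x, HasDerivAt U (U' x) x)
    (hV : ∀ x, HasDerivAt V (V' x) x) (hU' : Continuous U') (hV' : Continuous V')
    (h0 : U 0 = V 0) :
    HasWeakDerivative (fun x => if x ≤ 0 then U x else V x)
      (fun x => if x ≤ 0 then U' x else V' x) := by
  have hUc : Continuous U := continuous_iff_continuousAt.2 fun x => (hU x).continuousAt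
  have hVc : Continuous V := continuous_iff_continuousAt.2 fun x => (hV x).continuousAt
  refine ⟨locallyIntegrable_piecewise hUc hVc, locallyIntegrable_piecewise hU' hV', ?_⟩
  intro φ hφ hc
  have hφc : Continuous φ := hφ.continuous
  have hφd : ∀ x, HasDerivAt φ (deriv φ x) x := fun x =>
    (hφ.differentiable (by simp) x).hasDerivAt
  have hφ'c : Continuous (deriv φ) := hφ.continuous_deriv (by simp)
  have hint : ∀ {W ψ : ℝ → ℝ}, Continuous W → Continuous ψ → HasCompactSupport ψ →
      Integrable (fun x => W x * ψ x) := fun hW hψ hψc =>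
    (hW.mul hψ).integrable_of_hasCompactSupport hψc.mul_left
  rw [integral_piecewise_mul hUc hVc hφ'c hc.deriv, integral_piecewise_mul hU' hV' hφc hc]
  have key1 : ∫ x in Set.Iic 0, (U' x * φ x + U x * deriv φ x) = U 0 * φ 0 - 0 := by
    refine integral_Iic_of_hasDerivAt_of_tendsto (f := fun x => U x * φ x)
      (hUc.mul hφc).continuousWithinAt (fun x _ => (hU x).mul (hφd x))
      ((hint hU' hφc hc).add (hint hUc hφ'c hc.deriv)).integrableOn ?_
    have h : HasCompactSupport fun x => U x * φ x := hc.mul_left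
    exact h.is_zero_at_infty.mono_left atBot_le_cocompact
  have key2 : ∫ x in Set.Ioi 0, (V' x * φ x + V x * deriv φ x) = 0 - V 0 * φ 0 := by
    refine integral_Ioi_of_hasDerivAt_of_tendsto (f := fun x => V x * φ x)
      (hVc.mul hφc).continuousWithinAt (fun x _ => (hV x).mul (hφd x))
      ((hint hV' hφc hc).add (hint hVc hφ'c hc.deriv)).integrableOn ?_
    have h : HasCompactSupport fun x => V x * φ x := hc.mul_left
    exact h.is_zero_at_infty.mono_left atTop_le_cocompact
  rw [integral_add (hint hU' hφc hc).integrableOn (hint hUc hφ'c hc.deriv).integrableOn] at key1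
  rw [integral_add (hint hV' hφc hc).integrableOn (hint hVc hφ'c hc.deriv).integrableOn] at key2
  rw [h0] at key1
  linarith

/-! ### The heat kernel -/

/-- The Gaussian heat kernel of `∂ₜ q = ½ ∂ᵧ² q`. -/
noncomputable def heatKernel (t y : ℝ) : ℝ :=
  1 / √(2 * Real.pi * t) * Real.exp (-y ^ 2 / (2 * t))

theorem heatKernel_nonneg (t y : ℝ) : 0 ≤ heatKernel t y := by
  unfold heatKernel; positivity

theorem continuous_heatKernel (t : ℝ) : Continuous (heatKernel t) := by
  unfold heatKernel; fun_prop

theorem heatKernel_neg (t y : ℝ) : heatKernel t (-y) = heatKernel t y := by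
  simp [heatKernel]

theorem heatKernel_abs (t y : ℝ) : heatKernel t |y| = heatKernel t y := by
  simp [heatKernel]

theorem heatKernel_anti {t y z : ℝ} (ht : 0 < t) (h : |y| ≤ |z|) :
    heatKernel t z ≤ heatKernel t y := by
  unfold heatKernel
  have := sq_le_sq.2 h
  gcongr

theorem hasDerivAt_heatKernel_space (t y : ℝ) :
    HasDerivAt (heatKernel t) (-(y / t) * heatKernel t y) y := by
  have h : HasDerivAt (fun y : ℝ => -y ^ 2 / (2 * t)) (-(y / t)) y := by
    refine (((hasDerivAt_pow 2 y).fun_neg).div_const (2 * t)).congr_deriv ?_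
    rcases eq_or_ne t 0 with rfl | ht
    · simp
    · push_cast; field_simp
  refine ((h.exp).const_mul (1 / √(2 * Real.pi * t))).congr_deriv ?_
  unfold heatKernel; ring

theorem hasDerivAt_heatKernel_space_deriv (t y : ℝ) :
    HasDerivAt (fun y => -(y / t) * heatKernel t y)
      ((y ^ 2 / t ^ 2 - 1 / t) * heatKernel t y) y := by
  have h : HasDerivAt (fun y : ℝ => -(y / t)) (-(1 / t)) y :=
    ((hasDerivAt_id y).div_const t).fun_neg
  refine (h.fun_mul (hasDerivAt_heatKernel_space t y)).congr_deriv ?_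
  ring

theorem hasDerivAt_heatKernel_time {t : ℝ} (ht : 0 < t) (y : ℝ) :
    HasDerivAt (fun s => heatKernel s y)
      ((y ^ 2 / t ^ 2 - 1 / t) * heatKernel t y / 2) t := by
  have hp : 0 < 2 * Real.pi * t := by positivity
  have hs : 0 < √(2 * Real.pi * t) := Real.sqrt_pos.2 hp
  have h1 : HasDerivAt (fun s : ℝ => 2 * Real.pi * s) (2 * Real.pi) t := by
    simpa using (hasDerivAt_id t).const_mul (2 * Real.pi)
  have h2 := ((h1.sqrt hp.ne').fun_inv hs.ne')
  have h3 : HasDerivAt (fun s : ℝ => -y ^ 2 / (2 * s)) (y ^ 2 / (2 * t ^ 2)) t := by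
    have h4 : HasDerivAt (fun s : ℝ => 2 * s) 2 t := by
      simpa using (hasDerivAt_id t).const_mul (2 : ℝ)
    refine ((hasDerivAt_const t (-y ^ 2)).fun_div h4 (by positivity)).congr_deriv ?_
    field_simp
    ring
  have h5 := h2.fun_mul h3.exp
  have : (fun s => heatKernel s y) =
      fun s : ℝ => (√(2 * Real.pi * s))⁻¹ * Real.exp (-y ^ 2 / (2 * s)) := by
    funext s; simp [heatKernel]
  rw [this]
  refine h5.congr_deriv ?_
  unfold heatKernel
  have hsq : √(2 * Real.pi * t) ^ 2 = 2 * Real.pi * t := Real.sq_sqrt hp.le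
  rw [hsq]
  have := Real.pi_pos
  field_simp
  ring

theorem heatKernel_eq_gaussianPDFReal {t : ℝ} (ht : 0 < t) (y : ℝ) :
    heatKernel t y = gaussianPDFReal 0 (Real.toNNReal t) y := by
  simp [heatKernel, gaussianPDFReal, ht.le]

theorem integrable_heatKernel {t : ℝ} (ht : 0 < t) : Integrable (heatKernel t) := by
  rw [show heatKernel t = gaussianPDFReal 0 (Real.toNNReal t) from
    funext (heatKernel_eq_gaussianPDFReal ht)]
  exact integrable_gaussianPDFReal _ _

theorem integral_heatKernel {t : ℝ} (ht : 0 < t) : ∫ y, heatKernel t y = 1 := by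
  simp_rw [heatKernel_eq_gaussianPDFReal ht]
  exact integral_gaussianPDFReal_eq_one 0 (Real.toNNReal_pos.2 ht).ne'

/-- Brownian scaling: after `y = √t v` the Gaussian weight no longer depends on `t`. -/
theorem heatKernel_scale {t : ℝ} (ht : 0 < t) (v : ℝ) :
    √t * heatKernel t (√t * v) = heatKernel 1 v := by
  have hs : 0 < √t := Real.sqrt_pos.2 ht
  have h : √t ^ 2 = t := Real.sq_sqrt ht.le
  unfold heatKernel
  rw [Real.sqrt_mul (by positivity), mul_pow, h]
  have h2 : -(t * v ^ 2) / (2 * t) = -v ^ 2 / (2 * 1) := by field_simp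
  rw [h2]
  simp only [mul_one]
  field_simp

/-- The sign with value `-1` at the origin. -/
theorem abs_twoPhase_sign (y : ℝ) : |twoPhase (-1) 1 y| = 1 := by
  unfold twoPhase; split_ifs <;> simp

theorem measurable_twoPhase (c₁ c₂ : ℝ) : Measurable (twoPhase c₁ c₂) :=
  Measurable.ite measurableSet_Iic measurable_const measurable_const

theorem twoPhase_sign_mul_abs (y : ℝ) : twoPhase (-1) 1 y * |y| = y := by
  unfold twoPhase
  split_ifs with h
  · rw [abs_of_nonpos h]; ring
  · rw [abs_of_pos (not_le.mp h)]; ring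

/-- The reflection `y ↦ -y` changes the sign of the integrand off the origin, so the integral equals
its own negative. No integrability is needed, since a divergent Bochner integral is zero by
convention. -/
theorem integral_sign_mul_even (φ : ℝ → ℝ) : ∫ y, twoPhase (-1) 1 y * φ |y| = 0 := by
  have h1 : ∫ y, twoPhase (-1) 1 y * φ |y| = ∫ y, -(twoPhase (-1) 1 y * φ |y|) := by
    rw [← integral_neg_eq_self]
    refine integral_congr_ae ?_
    filter_upwards [Measure.ae_ne volume (0 : ℝ)] with y hy
    rw [abs_neg]
    unfold twoPhase
    rcases lt_or_gt_of_ne hy with h | h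
    · rw [if_neg (by linarith), if_pos h.le]; ring
    · rw [if_pos (by linarith), if_neg (by linarith)]; ring
  rw [integral_neg] at h1
  linarith

/-! ### The kernel in rescaled coordinates -/

/-- The transition density of skew Brownian motion with skewness `l`, with respect to Lebesgue
measure. -/
noncomputable def skewKernel (l t u y : ℝ) : ℝ :=
  heatKernel t (u - y) + l * (twoPhase (-1) 1 y * heatKernel t (|u| + |y|))

theorem twoPhase_pos {c₁ c₂ : ℝ} (h₁ : 0 < c₁) (h₂ : 0 < c₂) (x : ℝ) : 0 < twoPhase c₁ c₂ x := by
  unfold twoPhase; split_ifs <;> assumption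

theorem rescale_nonpos_iff {a₁ a₂ : ℝ} (h₁ : 0 < a₁) (h₂ : 0 < a₂) (z : ℝ) :
    rescale a₁ a₂ z ≤ 0 ↔ z ≤ 0 := by
  have := Real.sqrt_pos.2 (twoPhase_pos h₁ h₂ z)
  unfold rescale
  rw [div_le_iff₀ this, zero_mul]

theorem twoPhase_rescale {a₁ a₂ : ℝ} (h₁ : 0 < a₁) (h₂ : 0 < a₂) (c₁ c₂ z : ℝ) :
    twoPhase c₁ c₂ (rescale a₁ a₂ z) = twoPhase c₁ c₂ z := by
  simp only [twoPhase, rescale_nonpos_iff h₁ h₂]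

theorem fundSol_eq {a₁ a₂ : ℝ} (h₁ : 0 < a₁) (h₂ : 0 < a₂) (ρ₁ ρ₂ : ℝ) {t : ℝ} (ht : 0 < t)
    (x z : ℝ) :
    fundSol a₁ a₂ ρ₁ ρ₂ t x z = 1 / √(twoPhase a₁ a₂ z) *
      skewKernel (skewness a₁ a₂ ρ₁ ρ₂) t (rescale a₁ a₂ x) (rescale a₁ a₂ z) := by
  unfold fundSol skewKernel heatKernel
  rw [if_pos ht, twoPhase_rescale h₁ h₂]
  ring

theorem fundSol_of_nonpos (a₁ a₂ ρ₁ ρ₂ : ℝ) {t : ℝ} (ht : t ≤ 0) (x z : ℝ) :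
    fundSol a₁ a₂ ρ₁ ρ₂ t x z = 0 := by
  unfold fundSol; rw [if_neg (not_lt.2 ht)]

theorem abs_skewness_le {a₁ a₂ ρ₁ ρ₂ : ℝ} (ha₁ : 0 < a₁) (ha₂ : 0 < a₂) (hρ₁ : 0 < ρ₁)
    (hρ₂ : 0 < ρ₂) : |skewness a₁ a₂ ρ₁ ρ₂| ≤ 1 := by
  have h1 : 0 < ρ₁ * √a₁ := mul_pos hρ₁ (Real.sqrt_pos.2 ha₁)
  have h2 : 0 < ρ₂ * √a₂ := mul_pos hρ₂ (Real.sqrt_pos.2 ha₂)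
  unfold skewness
  rw [abs_div, abs_of_pos (add_pos h2 h1), div_le_one (add_pos h2 h1), abs_le]
  constructor <;> linarith

/-- The inverse of `rescale`. -/
noncomputable def unscale (a₁ a₂ y : ℝ) : ℝ := y * √(twoPhase a₁ a₂ y)

theorem unscale_rescale {a₁ a₂ : ℝ} (h₁ : 0 < a₁) (h₂ : 0 < a₂) (z : ℝ) :
    unscale a₁ a₂ (rescale a₁ a₂ z) = z := by
  unfold unscale
  rw [twoPhase_rescale h₁ h₂]
  exact div_mul_cancel₀ _ (Real.sqrt_pos.2 (twoPhase_pos h₁ h₂ z)).ne'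

theorem rescale_unscale {a₁ a₂ : ℝ} (h₁ : 0 < a₁) (h₂ : 0 < a₂) (y : ℝ) :
    rescale a₁ a₂ (unscale a₁ a₂ y) = y := by
  have hp := Real.sqrt_pos.2 (twoPhase_pos h₁ h₂ y)
  have h : twoPhase a₁ a₂ (unscale a₁ a₂ y) = twoPhase a₁ a₂ y := by
    have : unscale a₁ a₂ y ≤ 0 ↔ y ≤ 0 := by
      unfold unscale
      rw [← le_div_iff₀ hp, zero_div]
    unfold twoPhase
    simp only [this]
  rw [rescale, h]
  exact mul_div_cancel_right₀ _ hp.ne'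

theorem continuous_unscale (a₁ a₂ : ℝ) : Continuous (unscale a₁ a₂) := by
  have : unscale a₁ a₂ = fun y => if y ≤ 0 then y * √a₁ else y * √a₂ := by
    funext y; unfold unscale twoPhase; split_ifs <;> rfl
  rw [this]
  refine Continuous.if_le (by fun_prop) (by fun_prop) continuous_id continuous_const ?_
  rintro x rfl
  simp

theorem hasDerivAt_rescale (a₁ a₂ : ℝ) {z : ℝ} (hz : z ≠ 0) :
    HasDerivAt (rescale a₁ a₂) (1 / √(twoPhase a₁ a₂ z)) z := by
  have h : HasDerivAt (fun y => y / √(twoPhase a₁ a₂ z)) (1 / √(twoPhase a₁ a₂ z)) z :=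
    (hasDerivAt_id z).div_const _
  refine h.congr_of_eventuallyEq ?_
  rcases lt_or_gt_of_ne hz with h' | h'
  · filter_upwards [Iio_mem_nhds h'] with y hy
    simp [rescale, twoPhase, h'.le, (Set.mem_Iio.1 hy).le]
  · filter_upwards [Ioi_mem_nhds h'] with y hy
    simp [rescale, twoPhase, not_le.2 h', not_le.2 (Set.mem_Ioi.1 hy)]

theorem rescale_image_compl_zero {a₁ a₂ : ℝ} (h₁ : 0 < a₁) (h₂ : 0 < a₂) :
    rescale a₁ a₂ '' {0}ᶜ = {0}ᶜ := by
  ext y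
  constructor
  · rintro ⟨z, hz, rfl⟩ h
    refine hz ?_
    rw [Set.mem_singleton_iff] at h ⊢
    rw [← unscale_rescale h₁ h₂ z, h, unscale, zero_mul]
  · intro hy
    refine ⟨unscale a₁ a₂ y, fun h => hy ?_, rescale_unscale h₁ h₂ y⟩
    rw [Set.mem_singleton_iff] at h ⊢
    rw [← rescale_unscale h₁ h₂ y, h, rescale, zero_div]

/-- Change of variables on the complement of the origin: `rescale` may have a kink at `0`, but it
maps that complement bijectively onto itself and a point is null. -/
theorem integrable_comp_rescale_iff {a₁ a₂ : ℝ} (h₁ : 0 < a₁) (h₂ : 0 < a₂) (F : ℝ → ℝ) :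
    Integrable (fun z => 1 / √(twoPhase a₁ a₂ z) * F (rescale a₁ a₂ z)) ↔ Integrable F := by
  have h := integrableOn_image_iff_integrableOn_abs_deriv_smul (s := {(0 : ℝ)}ᶜ)
    (measurableSet_singleton 0).compl
    (fun z hz => (hasDerivAt_rescale a₁ a₂ hz).hasDerivWithinAt)
    (Function.LeftInverse.injective (unscale_rescale h₁ h₂)).injOn F
  rw [rescale_image_compl_zero h₁ h₂, IntegrableOn, IntegrableOn,
    restrict_compl_singleton] at h
  rw [h]
  refine integrable_congr (Eventually.of_forall fun z => ?_)
  simp only [smul_eq_mul]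
  rw [abs_of_pos (one_div_pos.2 (Real.sqrt_pos.2 (twoPhase_pos h₁ h₂ z)))]

theorem integral_comp_rescale {a₁ a₂ : ℝ} (h₁ : 0 < a₁) (h₂ : 0 < a₂) (F : ℝ → ℝ) :
    ∫ z, 1 / √(twoPhase a₁ a₂ z) * F (rescale a₁ a₂ z) = ∫ y, F y := by
  have h := integral_image_eq_integral_abs_deriv_smul (s := {(0 : ℝ)}ᶜ)
    (measurableSet_singleton 0).compl
    (fun z hz => (hasDerivAt_rescale a₁ a₂ hz).hasDerivWithinAt)
    (Function.LeftInverse.injective (unscale_rescale h₁ h₂)).injOn F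
  rw [rescale_image_compl_zero h₁ h₂, restrict_compl_singleton] at h
  rw [h]
  refine integral_congr_ae (Eventually.of_forall fun z => ?_)
  simp only [smul_eq_mul]
  rw [abs_of_pos (one_div_pos.2 (Real.sqrt_pos.2 (twoPhase_pos h₁ h₂ z)))]

/-! ### Mass and positivity of the kernel. -/

theorem integrable_sign_mul_heatKernel {t : ℝ} (ht : 0 < t) {c : ℝ} (hc : 0 ≤ c) :
    Integrable (fun y => twoPhase (-1) 1 y * heatKernel t (c + |y|)) := by
  refine (integrable_heatKernel ht).mono' ?_ (Eventually.of_forall fun y => ?_)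
  · exact ((measurable_twoPhase _ _).mul ((continuous_heatKernel t).measurable.comp
      (by fun_prop))).aestronglyMeasurable
  · rw [norm_mul, Real.norm_eq_abs, abs_twoPhase_sign, one_mul, Real.norm_eq_abs,
      abs_of_nonneg (heatKernel_nonneg _ _)]
    refine heatKernel_anti ht ?_
    rw [abs_of_nonneg (add_nonneg hc (abs_nonneg y))]
    linarith

theorem integrable_skewKernel (l : ℝ) {t : ℝ} (ht : 0 < t) (u : ℝ) :
    Integrable (skewKernel l t u) :=
  ((integrable_heatKernel ht).comp_sub_left u).add
    ((integrable_sign_mul_heatKernel ht (abs_nonneg u)).const_mul l)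

theorem integral_skewKernel (l : ℝ) {t : ℝ} (ht : 0 < t) (u : ℝ) :
    ∫ y, skewKernel l t u y = 1 := by
  unfold skewKernel
  rw [integral_add ((integrable_heatKernel ht).comp_sub_left u)
    ((integrable_sign_mul_heatKernel ht (abs_nonneg u)).const_mul l),
    integral_const_mul, integral_sign_mul_even (fun r => heatKernel t (|u| + r)),
    integral_sub_left_eq_self (heatKernel t), integral_heatKernel ht]
  simp

/-- The image term sits at distance `|u| + |y| ≥ |u - y|` and carries a weight of modulus at most
one, so the direct Gaussian term dominates it. -/
theorem skewKernel_nonneg {l : ℝ} (hl : |l| ≤ 1) {t : ℝ} (ht : 0 < t) (u y : ℝ) :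
    0 ≤ skewKernel l t u y := by
  have h1 : heatKernel t (|u| + |y|) ≤ heatKernel t (u - y) := by
    refine heatKernel_anti ht ?_
    rw [abs_of_nonneg (add_nonneg (abs_nonneg u) (abs_nonneg y))]
    exact abs_sub u y
  have h2 : |l * (twoPhase (-1) 1 y * heatKernel t (|u| + |y|))| ≤ heatKernel t (|u| + |y|) := by
    rw [abs_mul, abs_mul, abs_twoPhase_sign, one_mul, abs_of_nonneg (heatKernel_nonneg _ _)]
    exact mul_le_of_le_one_left (heatKernel_nonneg _ _) hl
  have := (abs_le.1 h2).1
  unfold skewKernel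
  linarith

theorem integrable_fundSol {a₁ a₂ : ℝ} (h₁ : 0 < a₁) (h₂ : 0 < a₂) (ρ₁ ρ₂ : ℝ) {t : ℝ}
    (ht : 0 < t) (x : ℝ) : Integrable (fundSol a₁ a₂ ρ₁ ρ₂ t x) := by
  rw [show fundSol a₁ a₂ ρ₁ ρ₂ t x = _ from funext (fundSol_eq h₁ h₂ ρ₁ ρ₂ ht x),
    integrable_comp_rescale_iff h₁ h₂]
  exact integrable_skewKernel _ ht _

theorem integral_fundSol {a₁ a₂ : ℝ} (h₁ : 0 < a₁) (h₂ : 0 < a₂) (ρ₁ ρ₂ : ℝ) {t : ℝ}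
    (ht : 0 < t) (x : ℝ) : ∫ z, fundSol a₁ a₂ ρ₁ ρ₂ t x z = 1 := by
  simp_rw [fundSol_eq h₁ h₂ ρ₁ ρ₂ ht x]
  rw [integral_comp_rescale h₁ h₂]
  exact integral_skewKernel _ ht _

theorem fundSol_nonneg {a₁ a₂ ρ₁ ρ₂ : ℝ} (ha₁ : 0 < a₁) (ha₂ : 0 < a₂) (hρ₁ : 0 < ρ₁)
    (hρ₂ : 0 < ρ₂) {t : ℝ} (ht : 0 < t) (x z : ℝ) : 0 ≤ fundSol a₁ a₂ ρ₁ ρ₂ t x z := by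
  rw [fundSol_eq ha₁ ha₂ ρ₁ ρ₂ ht]
  exact mul_nonneg (by positivity) (skewKernel_nonneg (abs_skewness_le ha₁ ha₂ hρ₁ hρ₂) ht _ _)

theorem abs_integral_fundSol_mul_le {a₁ a₂ ρ₁ ρ₂ : ℝ} (ha₁ : 0 < a₁) (ha₂ : 0 < a₂)
    (hρ₁ : 0 < ρ₁) (hρ₂ : 0 < ρ₂) {t : ℝ} (ht : 0 < t) (x : ℝ) {ξ : ℝ → ℝ} {M : ℝ}
    (hξ : ∀ x, |ξ x| ≤ M) : |∫ z, fundSol a₁ a₂ ρ₁ ρ₂ t x z * ξ z| ≤ M := by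
  have h := norm_integral_le_of_norm_le
    ((integrable_fundSol ha₁ ha₂ ρ₁ ρ₂ ht x).mul_const M)
    (f := fun z => fundSol a₁ a₂ ρ₁ ρ₂ t x z * ξ z) (Eventually.of_forall fun z => ?_)
  · rwa [integral_mul_const, integral_fundSol ha₁ ha₂ ρ₁ ρ₂ ht x, one_mul] at h
  · rw [norm_mul, Real.norm_eq_abs, abs_of_nonneg (fundSol_nonneg ha₁ ha₂ hρ₁ hρ₂ ht x z)]
    exact mul_le_mul_of_nonneg_left (hξ z) (fundSol_nonneg ha₁ ha₂ hρ₁ hρ₂ ht x z)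

/-! ### The initial condition -/

theorem integral_mul_comp_sqrt {t : ℝ} (ht : 0 < t) (g : ℝ → ℝ) :
    ∫ y, g y = ∫ v, √t * g (√t * v) := by
  have hs : 0 < √t := Real.sqrt_pos.2 ht
  rw [integral_const_mul, Measure.integral_comp_mul_left, abs_of_pos (inv_pos.2 hs), smul_eq_mul,
    mul_inv_cancel_left₀ hs.ne']

theorem tendsto_sqrt_nhdsGT_zero : Tendsto (fun t : ℝ => √t) (𝓝[>] 0) (𝓝[>] 0) := by
  refine tendsto_nhdsWithin_iff.2 ⟨?_, ?_⟩
  · have := (Real.continuous_sqrt.tendsto 0)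
    rw [Real.sqrt_zero] at this
    exact this.mono_left nhdsWithin_le_nhds
  · filter_upwards [self_mem_nhdsWithin] with t ht using Real.sqrt_pos.2 ht

/-- The substitution `y = u - √t v` moves the dependence on `t` from the Gaussian to the bounded
continuous factor, and `M * heatKernel 1 v` dominates. -/
theorem tendsto_integral_heatKernel_mul {F : ℝ → ℝ} (hF : Continuous F) {M : ℝ}
    (hM : ∀ y, |F y| ≤ M) (u : ℝ) :
    Tendsto (fun t => ∫ y, heatKernel t (u - y) * F y) (𝓝[>] 0) (𝓝 (F u)) := by
  have hlim : Tendsto (fun t => ∫ v, heatKernel 1 v * F (u - √t * v)) (𝓝[>] 0)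
      (𝓝 (∫ v, heatKernel 1 v * F u)) := by
    refine tendsto_integral_filter_of_dominated_convergence (fun v => heatKernel 1 v * M)
      (Eventually.of_forall fun t => ?_) (Eventually.of_forall fun t =>
        Eventually.of_forall fun v => ?_) ((integrable_heatKernel one_pos).mul_const M)
      (Eventually.of_forall fun v => ?_)
    · exact ((continuous_heatKernel 1).mul (by fun_prop)).aestronglyMeasurable
    · rw [norm_mul, Real.norm_eq_abs, abs_of_nonneg (heatKernel_nonneg _ _)]
      exact mul_le_mul_of_nonneg_left (hM _) (heatKernel_nonneg _ _)
    · refine Tendsto.const_mul _ ?_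
      have : Tendsto (fun t : ℝ => u - √t * v) (𝓝[>] 0) (𝓝 (u - 0 * v)) :=
        ((tendsto_sqrt_nhdsGT_zero.mono_right nhdsWithin_le_nhds).mul_const v).const_sub u
      rw [zero_mul, sub_zero] at this
      exact (hF.tendsto u).comp this
  rw [integral_mul_const, integral_heatKernel one_pos, one_mul] at hlim
  refine hlim.congr' ?_
  filter_upwards [self_mem_nhdsWithin] with t ht
  have h := integral_sub_left_eq_self (fun y => heatKernel t (u - y) * F y) volume u
  simp only [sub_sub_cancel] at h
  rw [← h, integral_mul_comp_sqrt ht fun v => heatKernel t v * F (u - v)]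
  simp_rw [← mul_assoc, heatKernel_scale ht]

theorem tendsto_integral_sign_heatKernel_mul {F : ℝ → ℝ} (hF : Continuous F) {M : ℝ}
    (hM : ∀ y, |F y| ≤ M) (u : ℝ) :
    Tendsto (fun t => ∫ y, twoPhase (-1) 1 y * heatKernel t (|u| + |y|) * F y) (𝓝[>] 0)
      (𝓝 0) := by
  have hresc : ∀ t : ℝ, 0 < t → ∫ y, twoPhase (-1) 1 y * heatKernel t (|u| + |y|) * F y =
      ∫ v, twoPhase (-1) 1 v * heatKernel 1 (|u| / √t + |v|) * F (√t * v) := by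
    intro t ht
    have hs : 0 < √t := Real.sqrt_pos.2 ht
    rw [integral_mul_comp_sqrt ht]
    congr 1
    funext v
    rw [← heatKernel_scale ht (|u| / √t + |v|), mul_add, mul_div_cancel₀ _ hs.ne', abs_mul,
      abs_of_pos hs]
    have : twoPhase (-1) 1 (√t * v) = twoPhase (-1) 1 v := by
      have h : √t * v ≤ 0 ↔ v ≤ 0 := by
        constructor
        · intro h; by_contra hv; exact absurd h (not_le.2 (mul_pos hs (not_le.1 hv)))
        · exact fun h => mul_nonpos_of_nonneg_of_nonpos hs.le h
      simp only [twoPhase, h]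
    rw [this]
    ring
  -- For `u ≠ 0` the Gaussian argument `|u| / √t + |v|` tends to infinity, so the integrand vanishes
  -- in the limit. For `u = 0` a nonzero limit integrand remains, but it is an odd function times
  -- the constant `F 0`, so its integral is zero.
  have hlim : Tendsto (fun t => ∫ v, twoPhase (-1) 1 v * heatKernel 1 (|u| / √t + |v|) *
      F (√t * v)) (𝓝[>] 0)
      (𝓝 (∫ v, twoPhase (-1) 1 v * (if u = 0 then heatKernel 1 |v| * F 0 else 0))) := by
    refine tendsto_integral_filter_of_dominated_convergence (fun v => heatKernel 1 v * M)
      (Eventually.of_forall fun t => ?_) (Eventually.of_forall fun t =>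
        Eventually.of_forall fun v => ?_) ((integrable_heatKernel one_pos).mul_const M)
      (Eventually.of_forall fun v => ?_)
    · exact (((measurable_twoPhase _ _).mul ((continuous_heatKernel 1).measurable.comp
        (by fun_prop))).mul (hF.measurable.comp (by fun_prop))).aestronglyMeasurable
    · rw [norm_mul, norm_mul, Real.norm_eq_abs, abs_twoPhase_sign, one_mul, Real.norm_eq_abs,
        abs_of_nonneg (heatKernel_nonneg _ _)]
      refine mul_le_mul (heatKernel_anti one_pos ?_) (hM _) (abs_nonneg _) (heatKernel_nonneg _ _)
      have : 0 ≤ |u| / √t := by positivity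
      rw [abs_of_nonneg (add_nonneg this (abs_nonneg v))]
      linarith
    · simp_rw [mul_assoc]
      refine Tendsto.const_mul _ ?_
      have hFt : Tendsto (fun t : ℝ => F (√t * v)) (𝓝[>] 0) (𝓝 (F 0)) := by
        have : Tendsto (fun t : ℝ => √t * v) (𝓝[>] 0) (𝓝 (0 * v)) :=
          (tendsto_sqrt_nhdsGT_zero.mono_right nhdsWithin_le_nhds).mul_const v
        rw [zero_mul] at this
        exact (hF.tendsto 0).comp this
      split_ifs with hu
      · subst hu
        simpa using hFt.const_mul (heatKernel 1 |v|)
      · have hq : Tendsto (heatKernel 1) atTop (𝓝 0) := by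
          have h : Tendsto (fun y : ℝ => -y ^ 2 / (2 * 1)) atTop atBot := by
            refine Tendsto.atBot_div_const (by norm_num) ?_
            exact tendsto_neg_atTop_atBot.comp (tendsto_pow_atTop (by norm_num))
          have h' := (Real.tendsto_exp_atBot.comp h).const_mul (1 / √(2 * Real.pi * 1))
          rwa [mul_zero] at h'
        have harg : Tendsto (fun t : ℝ => |u| / √t + |v|) (𝓝[>] 0) atTop := by
          refine tendsto_atTop_add_const_right _ _ ?_
          simp_rw [div_eq_mul_inv]
          exact (tendsto_inv_nhdsGT_zero.comp tendsto_sqrt_nhdsGT_zero).const_mul_atTop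
            (abs_pos.2 hu)
        simpa using (hq.comp harg).mul hFt
  rw [integral_sign_mul_even (fun r => if u = 0 then heatKernel 1 r * F 0 else 0)] at hlim
  refine hlim.congr' ?_
  filter_upwards [self_mem_nhdsWithin] with t ht
  exact (hresc t ht).symm

theorem tendsto_integral_fundSol_mul {a₁ a₂ : ℝ} (h₁ : 0 < a₁) (h₂ : 0 < a₂) (ρ₁ ρ₂ : ℝ)
    {f : ℝ → ℝ} (hf : Continuous f) {M : ℝ} (hM : ∀ x, |f x| ≤ M) (x : ℝ) :
    Tendsto (fun t => ∫ z, fundSol a₁ a₂ ρ₁ ρ₂ t x z * f z) (𝓝[>] 0) (𝓝 (f x)) := by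
  set F : ℝ → ℝ := fun y => f (unscale a₁ a₂ y) with hFdef
  have hF : Continuous F := hf.comp (continuous_unscale a₁ a₂)
  have hFM : ∀ y, |F y| ≤ M := fun y => hM _
  set u := rescale a₁ a₂ x with hu
  have hux : F u = f x := by rw [hFdef, hu]; simp only [unscale_rescale h₁ h₂]
  have hlim := (tendsto_integral_heatKernel_mul hF hFM u).add
    ((tendsto_integral_sign_heatKernel_mul hF hFM u).const_mul (skewness a₁ a₂ ρ₁ ρ₂))
  rw [mul_zero, add_zero, hux] at hlim
  refine hlim.congr' ?_
  filter_upwards [self_mem_nhdsWithin] with t ht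
  have h : ∀ z, fundSol a₁ a₂ ρ₁ ρ₂ t x z * f z = 1 / √(twoPhase a₁ a₂ z) *
      (fun y => skewKernel (skewness a₁ a₂ ρ₁ ρ₂) t u y * F y) (rescale a₁ a₂ z) := by
    intro z
    rw [fundSol_eq h₁ h₂ ρ₁ ρ₂ ht]
    simp only [hFdef, unscale_rescale h₁ h₂]
    ring
  simp_rw [h]
  rw [integral_comp_rescale h₁ h₂ (fun y => skewKernel (skewness a₁ a₂ ρ₁ ρ₂) t u y * F y)]
  have hb : ∀ {g : ℝ → ℝ}, Integrable g → Integrable fun y => g y * F y := fun hg =>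
    hg.mul_bdd (c := M) hF.aestronglyMeasurable (Eventually.of_forall hFM)
  rw [← integral_const_mul, ← integral_add (hb ((integrable_heatKernel ht).comp_sub_left u))
    ((hb (integrable_sign_mul_heatKernel ht (abs_nonneg u))).const_mul _)]
  congr 1
  funext y
  unfold skewKernel
  ring

/-! ### The equation -/

/-- The second space derivative of the heat kernel. -/
noncomputable def heatKernelLaplacian (t y : ℝ) : ℝ := (y ^ 2 / t ^ 2 - 1 / t) * heatKernel t y

/-- The smooth branch `c (q(t, x / s - w) + m q(t, ε x / s + |w|))` of the fundamental solution. -/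
noncomputable def branch (t c m w s ε x : ℝ) : ℝ :=
  c * (heatKernel t (x / s - w) + m * heatKernel t (ε * x / s + |w|))

/-- The first space derivative of `branch`. -/
noncomputable def branchDeriv (t c m w s ε x : ℝ) : ℝ :=
  c / s * (-((x / s - w) / t) * heatKernel t (x / s - w) +
    m * ε * (-((ε * x / s + |w|) / t) * heatKernel t (ε * x / s + |w|)))

/-- Half the second derivative in rescaled coordinates, which is the time derivative of
`branch`. -/
noncomputable def branchTime (t c m w s ε x : ℝ) : ℝ :=
  c * (heatKernelLaplacian t (x / s - w) / 2 + m * (heatKernelLaplacian t (ε * x / s + |w|) / 2))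

theorem hasDerivAt_branch (t c m w s ε x : ℝ) :
    HasDerivAt (branch t c m w s ε) (branchDeriv t c m w s ε x) x := by
  have h1 : HasDerivAt (fun x => x / s - w) (1 / s) x :=
    ((hasDerivAt_id x).div_const s).sub_const w
  have h2 : HasDerivAt (fun x => ε * x / s + |w|) (ε / s) x := by
    simpa using (((hasDerivAt_id x).const_mul ε).div_const s).add_const |w|
  have h3 := (hasDerivAt_heatKernel_space t (x / s - w)).comp x h1
  have h4 := (hasDerivAt_heatKernel_space t (ε * x / s + |w|)).comp x h2
  refine ((h3.add (h4.const_mul m)).const_mul c).congr_deriv ?_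
  unfold branchDeriv
  ring

/-- Differentiating the image term twice produces `ε²`, which is `1` for either orientation. The
factor `2 / s ^ 2` becomes `2 / a` when `s = √a`, which is the heat equation with coefficient `a /
2`. -/
theorem hasDerivAt_branchDeriv (t c m w s : ℝ) {ε : ℝ} (hε : ε * ε = 1) (x : ℝ) :
    HasDerivAt (branchDeriv t c m w s ε) (2 / s ^ 2 * branchTime t c m w s ε x) x := by
  have h1 : HasDerivAt (fun x => x / s - w) (1 / s) x :=
    ((hasDerivAt_id x).div_const s).sub_const w
  have h2 : HasDerivAt (fun x => ε * x / s + |w|) (ε / s) x := by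
    simpa using (((hasDerivAt_id x).const_mul ε).div_const s).add_const |w|
  have h3 := (hasDerivAt_heatKernel_space_deriv t (x / s - w)).comp x h1
  have h4 := (hasDerivAt_heatKernel_space_deriv t (ε * x / s + |w|)).comp x h2
  refine ((h3.add (h4.const_mul (m * ε))).const_mul (c / s)).congr_deriv ?_
  unfold branchTime heatKernelLaplacian
  linear_combination (c / s ^ 2 * m * (((ε * x / s + |w|) ^ 2 / t ^ 2 - 1 / t) *
    heatKernel t (ε * x / s + |w|))) * hε

theorem hasDerivAt_branch_time {t : ℝ} (ht : 0 < t) (c m w s ε x : ℝ) :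
    HasDerivAt (fun r => branch r c m w s ε x) (branchTime t c m w s ε x) t :=
  ((hasDerivAt_heatKernel_time ht _).add
    ((hasDerivAt_heatKernel_time ht _).const_mul m)).const_mul c

theorem continuous_branchTime (t c m w s ε : ℝ) : Continuous (branchTime t c m w s ε) := by
  have := continuous_heatKernel t
  unfold branchTime heatKernelLaplacian
  fun_prop

/-- With `s = √a₁`, `ε = -1` on the left and `s = √a₂`, `ε = 1` on the right, `|h x| = ε x / s`; the
absolute value in `x` disappears and each branch is smooth on the whole line. -/
theorem fundSol_eq_branch {a₁ a₂ : ℝ} (h₁ : 0 < a₁) (h₂ : 0 < a₂) (ρ₁ ρ₂ : ℝ) {t : ℝ}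
    (ht : 0 < t) (x z : ℝ) :
    fundSol a₁ a₂ ρ₁ ρ₂ t x z = branch t (1 / √(twoPhase a₁ a₂ z))
      (skewness a₁ a₂ ρ₁ ρ₂ * twoPhase (-1) 1 z) (rescale a₁ a₂ z)
      (if x ≤ 0 then √a₁ else √a₂) (if x ≤ 0 then -1 else 1) x := by
  rw [fundSol_eq h₁ h₂ ρ₁ ρ₂ ht]
  unfold branch skewKernel
  rw [twoPhase_rescale h₁ h₂, mul_assoc (skewness _ _ _ _)]
  split_ifs with hx
  · have : rescale a₁ a₂ x = x / √a₁ := by simp [rescale, twoPhase, hx]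
    rw [this, abs_of_nonpos (div_nonpos_of_nonpos_of_nonneg hx (Real.sqrt_nonneg _)), neg_one_mul,
      neg_div]
  · have : rescale a₁ a₂ x = x / √a₂ := by simp [rescale, twoPhase, hx]
    rw [this, abs_of_nonneg (div_nonneg (not_le.1 hx).le (Real.sqrt_nonneg _)), one_mul]

theorem hasDerivAt_fundSol_time {a₁ a₂ : ℝ} (h₁ : 0 < a₁) (h₂ : 0 < a₂) (ρ₁ ρ₂ : ℝ) {t : ℝ}
    (ht : 0 < t) (x z : ℝ) :
    HasDerivAt (fun r => fundSol a₁ a₂ ρ₁ ρ₂ r x z) (branchTime t (1 / √(twoPhase a₁ a₂ z))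
      (skewness a₁ a₂ ρ₁ ρ₂ * twoPhase (-1) 1 z) (rescale a₁ a₂ z)
      (if x ≤ 0 then √a₁ else √a₂) (if x ≤ 0 then -1 else 1) x) t := by
  refine (hasDerivAt_branch_time ht _ _ _ _ _ _).congr_of_eventuallyEq ?_
  filter_upwards [Ioi_mem_nhds ht] with r hr using fundSol_eq_branch h₁ h₂ ρ₁ ρ₂ hr x z

/-- The flux `a ρ ∂ₓ G` is continuous across the interface. -/
theorem flux_branchDeriv_zero {a₁ a₂ ρ₁ ρ₂ : ℝ} (ha₁ : 0 < a₁) (ha₂ : 0 < a₂) (hρ₁ : 0 < ρ₁)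
    (hρ₂ : 0 < ρ₂) (t c z : ℝ) :
    a₁ * ρ₁ * branchDeriv t c (skewness a₁ a₂ ρ₁ ρ₂ * twoPhase (-1) 1 z) (rescale a₁ a₂ z)
        √a₁ (-1) 0 =
      a₂ * ρ₂ * branchDeriv t c (skewness a₁ a₂ ρ₁ ρ₂ * twoPhase (-1) 1 z) (rescale a₁ a₂ z)
        √a₂ 1 0 := by
  have hs : twoPhase (-1) 1 z * |rescale a₁ a₂ z| = rescale a₁ a₂ z := by
    rw [← twoPhase_rescale ha₁ ha₂ (-1) 1 z]
    exact twoPhase_sign_mul_abs _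
  have h1 := Real.sqrt_pos.2 ha₁
  have h2 := Real.sqrt_pos.2 ha₂
  have e1 : a₁ = √a₁ * √a₁ := (Real.mul_self_sqrt ha₁.le).symm
  have e2 : a₂ = √a₂ * √a₂ := (Real.mul_self_sqrt ha₂.le).symm
  unfold branchDeriv
  simp only [mul_zero, zero_div, zero_add, zero_sub, heatKernel_neg, heatKernel_abs]
  set w := rescale a₁ a₂ z
  set σ := twoPhase (-1) 1 z
  set l := skewness a₁ a₂ ρ₁ ρ₂ with hl
  -- At `x = 0` both Gaussians have the same value, and `sign(z) |w| = w` merges the two terms into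
  -- one with factor `1 + λ` on the left and `1 - λ` on the right.
  have k1 : a₁ * ρ₁ * (c / √a₁ * (-(-w / t) * heatKernel t w +
      l * σ * -1 * (-(|w| / t) * heatKernel t w))) =
      √a₁ * ρ₁ * (1 + l) * (c * w / t * heatKernel t w) := by
    have : a₁ * ρ₁ * (c / √a₁) = √a₁ * ρ₁ * c := by
      nth_rewrite 1 [e1]; field_simp
    rw [← mul_assoc, this]
    linear_combination (√a₁ * ρ₁ * c * l / t * heatKernel t w) * hs
  have k2 : a₂ * ρ₂ * (c / √a₂ * (-(-w / t) * heatKernel t w +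
      l * σ * 1 * (-(|w| / t) * heatKernel t w))) =
      √a₂ * ρ₂ * (1 - l) * (c * w / t * heatKernel t w) := by
    have : a₂ * ρ₂ * (c / √a₂) = √a₂ * ρ₂ * c := by
      nth_rewrite 1 [e2]; field_simp
    rw [← mul_assoc, this]
    linear_combination -(√a₂ * ρ₂ * c * l / t * heatKernel t w) * hs
  rw [k1, k2]
  have h3 : 0 < ρ₂ * √a₂ + ρ₁ * √a₁ := by positivity
  -- The equation that singles out `λ`.
  have : √a₁ * ρ₁ * (1 + l) = √a₂ * ρ₂ * (1 - l) := by
    rw [hl, skewness]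
    field_simp
    ring
  rw [this]

theorem isDivergenceImage_fundSol {a₁ a₂ ρ₁ ρ₂ : ℝ} (ha₁ : 0 < a₁) (ha₂ : 0 < a₂) (hρ₁ : 0 < ρ₁)
    (hρ₂ : 0 < ρ₂) {t : ℝ} (ht : 0 < t) (z : ℝ) :
    IsDivergenceImage a₁ a₂ ρ₁ ρ₂ (fun x => fundSol a₁ a₂ ρ₁ ρ₂ t x z)
      (fun x => deriv (fun s => fundSol a₁ a₂ ρ₁ ρ₂ s x z) t) := by
  set c := 1 / √(twoPhase a₁ a₂ z) with hc
  set m := skewness a₁ a₂ ρ₁ ρ₂ * twoPhase (-1) 1 z with hm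
  set w := rescale a₁ a₂ z with hw
  have hcont : ∀ (s : ℝ) {ε : ℝ}, ε * ε = 1 → Continuous (branchDeriv t c m w s ε) :=
    fun s ε hε => continuous_iff_continuousAt.2 fun x =>
      (hasDerivAt_branchDeriv t c m w s hε x).continuousAt
  refine ⟨fun x => if x ≤ 0 then branchDeriv t c m w √a₁ (-1) x else branchDeriv t c m w √a₂ 1 x,
    ?_, ?_⟩
  · have h : (fun x => fundSol a₁ a₂ ρ₁ ρ₂ t x z) =
        fun x => if x ≤ 0 then branch t c m w √a₁ (-1) x else branch t c m w √a₂ 1 x := by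
      funext x
      rw [fundSol_eq_branch ha₁ ha₂ ρ₁ ρ₂ ht]
      split_ifs <;> rfl
    rw [h]
    refine hasWeakDerivative_piecewise (hasDerivAt_branch _ _ _ _ _ _)
      (hasDerivAt_branch _ _ _ _ _ _) (hcont _ (by norm_num)) (hcont _ (by norm_num)) ?_
    -- At `x = 0` the value of `branch` does not involve `s` or `ε`, so the two sides agree.
    simp [branch]
  · have h : (fun x => twoPhase a₁ a₂ x * twoPhase ρ₁ ρ₂ x *
        if x ≤ 0 then branchDeriv t c m w √a₁ (-1) x else branchDeriv t c m w √a₂ 1 x) =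
        fun x => if x ≤ 0 then a₁ * ρ₁ * branchDeriv t c m w √a₁ (-1) x
          else a₂ * ρ₂ * branchDeriv t c m w √a₂ 1 x := by
      funext x
      unfold twoPhase
      split_ifs <;> rfl
    have h' : (fun x => 2 * twoPhase ρ₁ ρ₂ x * deriv (fun s => fundSol a₁ a₂ ρ₁ ρ₂ s x z) t) =
        fun x => if x ≤ 0 then 2 * ρ₁ * branchTime t c m w √a₁ (-1) x
          else 2 * ρ₂ * branchTime t c m w √a₂ 1 x := by
      funext x
      rw [(hasDerivAt_fundSol_time ha₁ ha₂ ρ₁ ρ₂ ht x z).deriv,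
        show twoPhase ρ₁ ρ₂ x = if x ≤ 0 then ρ₁ else ρ₂ from rfl]
      split_ifs <;> rfl
    rw [h, h']
    have hder : ∀ {a ρ ε : ℝ}, 0 < a → ε * ε = 1 → ∀ x,
        HasDerivAt (fun x => a * ρ * branchDeriv t c m w √a ε x)
          (2 * ρ * branchTime t c m w √a ε x) x := by
      intro a ρ ε ha hε x
      refine ((hasDerivAt_branchDeriv t c m w √a hε x).const_mul (a * ρ)).congr_deriv ?_
      rw [Real.sq_sqrt ha.le]
      field_simp
    exact hasWeakDerivative_piecewise (hder ha₁ (by norm_num)) (hder ha₂ (by norm_num))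
      ((continuous_branchTime _ _ _ _ _ _).const_mul _)
      ((continuous_branchTime _ _ _ _ _ _).const_mul _)
      (flux_branchDeriv_zero ha₁ ha₂ hρ₁ hρ₂ t c z)

theorem isFundamentalSolution_fundSol {a₁ a₂ ρ₁ ρ₂ : ℝ} (ha₁ : 0 < a₁) (ha₂ : 0 < a₂)
    (hρ₁ : 0 < ρ₁) (hρ₂ : 0 < ρ₂) :
    IsFundamentalSolution a₁ a₂ ρ₁ ρ₂ (fundSol a₁ a₂ ρ₁ ρ₂) where
  integrable _ x ht := integrable_fundSol ha₁ ha₂ ρ₁ ρ₂ ht x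
  differentiable _ x z ht := (hasDerivAt_fundSol_time ha₁ ha₂ ρ₁ ρ₂ ht x z).differentiableAt
  equation _ z ht := isDivergenceImage_fundSol ha₁ ha₂ hρ₁ hρ₂ ht z
  initial _ hf hM x := by
    obtain ⟨M, hM⟩ := hM
    exact tendsto_integral_fundSol_mul ha₁ ha₂ ρ₁ ρ₂ hf hM x

/-! ### Lebesgue measure on the time interval -/

theorem timeMeasure_apply (T : ℝ) (s : Set (Set.Icc (0 : ℝ) T)) :
    timeMeasure T s = volume (Subtype.val '' s) :=
  (MeasurableEmbedding.subtype_coe measurableSet_Icc).comap_apply _ _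

theorem timeMeasure_Ioc {T : ℝ} (a b : Set.Icc (0 : ℝ) T) :
    timeMeasure T (Set.Ioc a b) = ENNReal.ofReal ((b : ℝ) - a) := by
  have : Subtype.val '' Set.Ioc a b = Set.Ioc (a : ℝ) b := by
    ext x
    constructor
    · rintro ⟨y, hy, rfl⟩
      exact hy
    · rintro ⟨h1, h2⟩
      exact ⟨⟨x, a.2.1.trans h1.le, h2.trans b.2.2⟩, ⟨h1, h2⟩, rfl⟩
  rw [timeMeasure_apply, this, Real.volume_Ioc]

theorem timeMeasure_real_Ioc {T : ℝ} {a b : Set.Icc (0 : ℝ) T} (h : a ≤ b) :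
    (timeMeasure T).real (Set.Ioc a b) = (b : ℝ) - a := by
  rw [Measure.real, timeMeasure_Ioc, ENNReal.toReal_ofReal (sub_nonneg.2 h)]

instance isFiniteMeasure_timeMeasure (T : ℝ) : IsFiniteMeasure (timeMeasure T) := by
  refine ⟨?_⟩
  rw [timeMeasure_apply, Set.image_univ, Subtype.range_coe, Real.volume_Icc]
  exact ENNReal.ofReal_lt_top

theorem ae_ne_timeMeasure {T : ℝ} (a : Set.Icc (0 : ℝ) T) : ∀ᵐ s ∂timeMeasure T, s ≠ a := by
  rw [ae_iff]
  simp only [not_not, Set.ofPred_eq_eq_singleton]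
  rw [timeMeasure_apply, Set.image_singleton, Real.volume_singleton]

theorem enorm_sq_eq_ofReal (x : ℝ) : ‖x‖ₑ ^ 2 = ENNReal.ofReal (x ^ 2) := by
  rw [Real.enorm_eq_ofReal_abs, ← ENNReal.ofReal_pow (abs_nonneg x), sq_abs]

section Stochastic

variable {Ω : Type*} {mΩ : MeasurableSpace Ω} {P : Measure Ω} {T : ℝ}
  {𝓕 : Filtration (Set.Icc (0 : ℝ) T) mΩ} {B : Set.Icc (0 : ℝ) T → Ω → ℝ}

/-! ### Moments of Brownian increments -/

namespace IsFBrownianMotion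

theorem memLp_increment (hB : IsFBrownianMotion 𝓕 P B) {s t : Set.Icc (0 : ℝ) T} (h : s ≤ t) :
    MemLp (fun ω => B t ω - B s ω) 2 P := by
  have hl := hB.law s t h
  have h2 : MemLp id 2 (P.map fun ω => B t ω - B s ω) := by
    rw [hl.map_eq]
    exact memLp_id_gaussianReal 2
  exact h2.comp_of_map hl.aemeasurable

theorem integral_increment (hB : IsFBrownianMotion 𝓕 P B) {s t : Set.Icc (0 : ℝ) T}
    (h : s ≤ t) : ∫ ω, (B t ω - B s ω) ∂P = 0 :=
  (hB.law s t h).integral_eq.trans integral_id_gaussianReal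

theorem integral_increment_sq (hB : IsFBrownianMotion 𝓕 P B) {s t : Set.Icc (0 : ℝ) T}
    (h : s ≤ t) : ∫ ω, (B t ω - B s ω) ^ 2 ∂P = (t : ℝ) - s := by
  have hl := hB.law s t h
  rw [← variance_of_integral_eq_zero hl.aemeasurable (hB.integral_increment h), hl.variance_eq,
    variance_id_gaussianReal, Real.coe_toNNReal _ (sub_nonneg.2 h)]

theorem indepFun_increment (hB : IsFBrownianMotion 𝓕 P B) {s t : Set.Icc (0 : ℝ) T}
    (h : s ≤ t) {X : Ω → ℝ} (hX : StronglyMeasurable[𝓕 s] X) :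
    IndepFun X (fun ω => B t ω - B s ω) P := by
  rw [IndepFun_iff_Indep]
  exact indep_of_indep_of_le_left (hB.indep s t h).symm hX.measurable.comap_le

theorem integrable_mul_increment (hB : IsFBrownianMotion 𝓕 P B) [IsFiniteMeasure P]
    {s t : Set.Icc (0 : ℝ) T} (h : s ≤ t) {X : Ω → ℝ} (hX : StronglyMeasurable[𝓕 s] X)
    (hXi : Integrable X P) : Integrable (fun ω => X ω * (B t ω - B s ω)) P :=
  (hB.indepFun_increment h hX).integrable_mul hXi
    ((hB.memLp_increment h).integrable (by norm_num))

theorem integral_mul_increment (hB : IsFBrownianMotion 𝓕 P B) {s t : Set.Icc (0 : ℝ) T}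
    (h : s ≤ t) {X : Ω → ℝ} (hX : StronglyMeasurable[𝓕 s] X) :
    ∫ ω, X ω * (B t ω - B s ω) ∂P = 0 := by
  have := (hB.indepFun_increment h hX).integral_mul_eq_mul_integral
    (hX.mono (𝓕.le s)).aestronglyMeasurable (hB.memLp_increment h).1
  rw [hB.integral_increment h, mul_zero] at this
  exact this

theorem integrable_mul_increment_sq (hB : IsFBrownianMotion 𝓕 P B)
    {s t : Set.Icc (0 : ℝ) T} (h : s ≤ t) {X : Ω → ℝ} (hX : StronglyMeasurable[𝓕 s] X)
    (hXi : Integrable X P) : Integrable (fun ω => X ω * (B t ω - B s ω) ^ 2) P :=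
  ((hB.indepFun_increment h hX).comp measurable_id (measurable_id.pow_const 2)).integrable_mul hXi
    (hB.memLp_increment h).integrable_sq

theorem integral_mul_increment_sq (hB : IsFBrownianMotion 𝓕 P B) {s t : Set.Icc (0 : ℝ) T}
    (h : s ≤ t) {X : Ω → ℝ} (hX : StronglyMeasurable[𝓕 s] X) :
    ∫ ω, X ω * (B t ω - B s ω) ^ 2 ∂P = (∫ ω, X ω ∂P) * ((t : ℝ) - s) := by
  have := ((hB.indepFun_increment h hX).comp measurable_id
    (measurable_id.pow_const 2)).integral_mul_eq_mul_integral
    (hX.mono (𝓕.le s)).aestronglyMeasurable (hB.memLp_increment h).integrable_sq.1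
  rw [← hB.integral_increment_sq h]
  exact this

/-! ### The Itô isometry for elementary integrands -/

theorem integrable_coef_mul_increments (hB : IsFBrownianMotion 𝓕 P B) {X : Ω → ℝ}
    (hX : AEStronglyMeasurable X P) {C : ℝ} (hC : ∀ ω, |X ω| ≤ C)
    {l r l' r' : Set.Icc (0 : ℝ) T} (h : l ≤ r) (h' : l' ≤ r') :
    Integrable (fun ω => X ω * ((B r ω - B l ω) * (B r' ω - B l' ω))) P :=
  Integrable.bdd_mul (c := C) ((hB.memLp_increment h).integrable_mul (hB.memLp_increment h')) hX
    (Eventually.of_forall hC)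

/-- Cutting both increments at the endpoints of the overlap leaves the squared increment over the
overlap, whose mean is its length, and products in which the later increment is centred and
independent of everything before it. -/
theorem integral_coef_mul_increments_of_le (hB : IsFBrownianMotion 𝓕 P B) [IsFiniteMeasure P]
    {l r l' r' : Set.Icc (0 : ℝ) T} (h' : l' ≤ r') (hl : l ≤ l') {X : Ω → ℝ}
    (hX : StronglyMeasurable[𝓕 l'] X) {C : ℝ} (hC : ∀ ω, |X ω| ≤ C) :
    ∫ ω, X ω * ((B r ω - B l ω) * (B r' ω - B l' ω)) ∂P =
      (∫ ω, X ω ∂P) * (timeMeasure T).real (Set.Ioc l r ∩ Set.Ioc l' r') := by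
  have hX0 : ∀ {u : Set.Icc (0 : ℝ) T}, l' ≤ u → StronglyMeasurable[𝓕 u] X :=
    fun hu => hX.mono (𝓕.mono hu)
  have hXi : Integrable X P :=
    Integrable.of_bound (hX.mono (𝓕.le l')).aestronglyMeasurable C (Eventually.of_forall hC)
  have hBm : ∀ {u v : Set.Icc (0 : ℝ) T}, u ≤ v → StronglyMeasurable[𝓕 v] (B u) :=
    fun hu => (hB.adapted _).mono (𝓕.mono hu)
  have hXB : ∀ {u v : Set.Icc (0 : ℝ) T}, u ≤ v →
      Integrable (fun ω => X ω * (B v ω - B u ω)) P := fun hu =>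
    Integrable.bdd_mul (c := C) ((hB.memLp_increment hu).integrable (by norm_num)) hXi.1
      (Eventually.of_forall hC)
  rcases le_total r l' with hr | hr
  · have he : Set.Ioc l r ∩ Set.Ioc l' r' = ∅ := by
      rw [Set.Ioc_inter_Ioc]
      exact Set.Ioc_eq_empty (not_lt.2 (inf_le_left.trans (hr.trans le_sup_right)))
    rw [he, measureReal_empty, mul_zero]
    simp_rw [← mul_assoc]
    exact hB.integral_mul_increment h' (hX.mul ((hBm hr).sub (hBm hl)))
  -- Here `m` and `M` stand for the smaller and the larger of `r` and `r'`, so one computation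
  -- covers both orders.
  · have key : ∀ m M : Set.Icc (0 : ℝ) T, l' ≤ m → m ≤ M →
        (∀ ω, (B r ω - B l ω) * (B r' ω - B l' ω) = (B l' ω - B l ω) * (B r' ω - B l' ω) +
          ((B m ω - B l' ω) ^ 2 + (B m ω - B l' ω) * (B M ω - B m ω))) →
        ∫ ω, X ω * ((B r ω - B l ω) * (B r' ω - B l' ω)) ∂P =
          (∫ ω, X ω ∂P) * ((m : ℝ) - l') := by
      intro m M hm hM hdec
      have e : ∀ ω, X ω * ((B r ω - B l ω) * (B r' ω - B l' ω)) =
          X ω * (B l' ω - B l ω) * (B r' ω - B l' ω) +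
            (X ω * (B m ω - B l' ω) ^ 2 + X ω * (B m ω - B l' ω) * (B M ω - B m ω)) := by
        intro ω; rw [hdec]; ring
      have m1 : StronglyMeasurable[𝓕 l'] fun ω => X ω * (B l' ω - B l ω) :=
        hX.mul ((hBm le_rfl).sub (hBm hl))
      have m2 : StronglyMeasurable[𝓕 m] fun ω => X ω * (B m ω - B l' ω) :=
        (hX0 hm).mul ((hBm le_rfl).sub (hBm hm))
      have i1 := hB.integrable_mul_increment h' m1 (hXB hl)
      have i2 := hB.integrable_mul_increment_sq hm hX hXi
      have i3 := hB.integrable_mul_increment hM m2 (hXB hm)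
      simp_rw [e]
      rw [integral_add i1 (i2.fun_add i3), integral_add i2 i3, hB.integral_mul_increment h' m1,
        hB.integral_mul_increment hM m2, hB.integral_mul_increment_sq hm hX]
      ring
    rw [Set.Ioc_inter_Ioc, sup_eq_right.2 hl]
    rcases le_total r r' with hrr | hrr
    · rw [inf_eq_left.2 hrr, timeMeasure_real_Ioc hr]
      exact key r r' hr hrr fun ω => by ring
    · rw [inf_eq_right.2 hrr, timeMeasure_real_Ioc h']
      exact key r' r h' hrr fun ω => by ring

theorem integral_coef_mul_increments (hB : IsFBrownianMotion 𝓕 P B) [IsFiniteMeasure P]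
    {l r l' r' : Set.Icc (0 : ℝ) T} (h : l ≤ r) (h' : l' ≤ r') {c c' : Ω → ℝ}
    (hc : StronglyMeasurable[𝓕 l] c) (hc' : StronglyMeasurable[𝓕 l'] c') {C C' : ℝ}
    (hC : ∀ ω, |c ω| ≤ C) (hC' : ∀ ω, |c' ω| ≤ C') :
    ∫ ω, c ω * c' ω * ((B r ω - B l ω) * (B r' ω - B l' ω)) ∂P =
      (∫ ω, c ω * c' ω ∂P) * (timeMeasure T).real (Set.Ioc l r ∩ Set.Ioc l' r') := by
  have hb : ∀ ω, |c ω * c' ω| ≤ C * C' := fun ω => by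
    rw [abs_mul]
    exact mul_le_mul (hC ω) (hC' ω) (abs_nonneg _) ((abs_nonneg _).trans (hC ω))
  rcases le_total l l' with hl | hl
  · exact hB.integral_coef_mul_increments_of_le h' hl ((hc.mono (𝓕.mono hl)).mul hc') hb
  · simp_rw [mul_comm (B r _ - B l _)]
    rw [Set.inter_comm]
    exact hB.integral_coef_mul_increments_of_le h hl (hc.mul (hc'.mono (𝓕.mono hl))) hb

/-! ### Time integrals of squared step functions, and the isometry. -/

theorem indicator_sum_sq {ι : Type*} [Fintype ι] (l r : ι → Set.Icc (0 : ℝ) T) (c : ι → ℝ)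
    (s : Set.Icc (0 : ℝ) T) :
    (∑ i, (Set.Ioc (l i) (r i)).indicator (fun _ => c i) s) ^ 2 =
      ∑ i, ∑ j, (Set.Ioc (l i) (r i) ∩ Set.Ioc (l j) (r j)).indicator
        (fun _ => c i * c j) s := by
  rw [sq, Finset.sum_mul_sum]
  refine Finset.sum_congr rfl fun i _ => Finset.sum_congr rfl fun j _ => ?_
  rw [Set.inter_indicator_mul]

theorem integrable_indicator_inter {ι : Type*} (l r : ι → Set.Icc (0 : ℝ) T) (c : ι → ℝ)
    (i j : ι) : Integrable ((Set.Ioc (l i) (r i) ∩ Set.Ioc (l j) (r j)).indicator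
      (fun _ => c i * c j)) (timeMeasure T) :=
  (integrable_const _).indicator (measurableSet_Ioc.inter measurableSet_Ioc)

theorem integral_indicator_sum_sq {ι : Type*} [Fintype ι]
    (l r : ι → Set.Icc (0 : ℝ) T) (c : ι → ℝ) :
    ∫ s, (∑ i, (Set.Ioc (l i) (r i)).indicator (fun _ => c i) s) ^ 2 ∂timeMeasure T =
      ∑ i, ∑ j, c i * c j *
        (timeMeasure T).real (Set.Ioc (l i) (r i) ∩ Set.Ioc (l j) (r j)) := by
  have hi := integrable_indicator_inter l r c
  simp_rw [indicator_sum_sq]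
  rw [integral_finsetSum _ fun i _ => integrable_finsetSum _ fun j _ => hi i j]
  refine Finset.sum_congr rfl fun i _ => ?_
  rw [integral_finsetSum _ fun j _ => hi i j]
  refine Finset.sum_congr rfl fun j _ => ?_
  rw [integral_indicator_const _ (measurableSet_Ioc.inter measurableSet_Ioc), smul_eq_mul,
    mul_comm]

theorem lintegral_enorm_sq_indicator_sum {ι : Type*} [Fintype ι]
    (l r : ι → Set.Icc (0 : ℝ) T) (c : ι → ℝ) :
    ∫⁻ s, ‖∑ i, (Set.Ioc (l i) (r i)).indicator (fun _ => c i) s‖ₑ ^ 2 ∂timeMeasure T =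
      ENNReal.ofReal (∑ i, ∑ j, c i * c j *
        (timeMeasure T).real (Set.Ioc (l i) (r i) ∩ Set.Ioc (l j) (r j))) := by
  simp_rw [enorm_sq_eq_ofReal]
  rw [← integral_indicator_sum_sq,
    ofReal_integral_eq_lintegral_ofReal _ (Eventually.of_forall fun s => sq_nonneg _)]
  simp_rw [indicator_sum_sq]
  exact integrable_finsetSum _ fun i _ => integrable_finsetSum _ fun j _ =>
    integrable_indicator_inter l r c i j

/-- Both squares expand into double sums that agree term by term, by `integral_coef_mul_increments`.
The intervals may overlap arbitrarily, so no refinement to a common partition is needed. -/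
theorem ito_isometry (hB : IsFBrownianMotion 𝓕 P B) [IsFiniteMeasure P] {ι : Type*} [Fintype ι]
    {l r : ι → Set.Icc (0 : ℝ) T} (hlr : ∀ i, l i ≤ r i) {c : ι → Ω → ℝ}
    (hc : ∀ i, StronglyMeasurable[𝓕 (l i)] (c i)) (hC : ∀ i, ∃ C : ℝ, ∀ ω, |c i ω| ≤ C) :
    ∫⁻ ω, ‖∑ i, c i ω * (B (r i) ω - B (l i) ω)‖ₑ ^ 2 ∂P =
      ∫⁻ ω, ∫⁻ s, ‖∑ i, (Set.Ioc (l i) (r i)).indicator (fun _ => c i ω) s‖ₑ ^ 2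
        ∂timeMeasure T ∂P := by
  choose C hC using hC
  have hm : ∀ i j, AEStronglyMeasurable (fun ω => c i ω * c j ω) P := fun i j =>
    (((hc i).mono (𝓕.le _)).mul ((hc j).mono (𝓕.le _))).aestronglyMeasurable
  have hb : ∀ i j ω, |c i ω * c j ω| ≤ C i * C j := fun i j ω => by
    rw [abs_mul]
    exact mul_le_mul (hC i ω) (hC j ω) (abs_nonneg _) ((abs_nonneg _).trans (hC i ω))
  have hi : ∀ i j, Integrable (fun ω => c i ω * c j ω *
      ((B (r i) ω - B (l i) ω) * (B (r j) ω - B (l j) ω))) P := fun i j =>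
    hB.integrable_coef_mul_increments (hm i j) (hb i j) (hlr i) (hlr j)
  have hi' : ∀ i j, Integrable (fun ω => c i ω * c j ω *
      (timeMeasure T).real (Set.Ioc (l i) (r i) ∩ Set.Ioc (l j) (r j))) P := fun i j =>
    (Integrable.of_bound (hm i j) _ (Eventually.of_forall (hb i j))).mul_const _
  have e : ∀ ω, (∑ i, c i ω * (B (r i) ω - B (l i) ω)) ^ 2 = ∑ i, ∑ j, c i ω * c j ω *
      ((B (r i) ω - B (l i) ω) * (B (r j) ω - B (l j) ω)) := by
    intro ω
    rw [sq, Finset.sum_mul_sum]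
    exact Finset.sum_congr rfl fun i _ => Finset.sum_congr rfl fun j _ => by ring
  simp_rw [lintegral_enorm_sq_indicator_sum, enorm_sq_eq_ofReal]
  rw [← ofReal_integral_eq_lintegral_ofReal _ (Eventually.of_forall fun ω => sq_nonneg _),
    ← ofReal_integral_eq_lintegral_ofReal]
  · congr 1
    simp_rw [e]
    rw [integral_finsetSum _ fun i _ => integrable_finsetSum _ fun j _ => hi i j,
      integral_finsetSum _ fun i _ => integrable_finsetSum _ fun j _ => hi' i j]
    refine Finset.sum_congr rfl fun i _ => ?_
    rw [integral_finsetSum _ fun j _ => hi i j, integral_finsetSum _ fun j _ => hi' i j]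
    refine Finset.sum_congr rfl fun j _ => ?_
    rw [hB.integral_coef_mul_increments (hlr i) (hlr j) (hc i) (hc j) (hC i) (hC j),
      integral_mul_const]
  · exact integrable_finsetSum _ fun i _ => integrable_finsetSum _ fun j _ => hi' i j
  · refine Eventually.of_forall fun ω => ?_
    have h := integral_indicator_sum_sq l r fun i => c i ω
    simp only [Pi.zero_apply]
    rw [← h]
    exact integral_nonneg fun s => sq_nonneg _
  · simp_rw [e]
    exact integrable_finsetSum _ fun i _ => integrable_finsetSum _ fun j _ => hi i j

end IsFBrownianMotion

/-! ### The Itô integral of a constant integrand -/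

theorem enorm_sub_sq_le (a b c : ℝ) : ‖a - c‖ₑ ^ 2 ≤ 2 * (‖b - a‖ₑ ^ 2 + ‖b - c‖ₑ ^ 2) := by
  rw [enorm_sq_eq_ofReal, enorm_sq_eq_ofReal, enorm_sq_eq_ofReal,
    ← ENNReal.ofReal_add (sq_nonneg _) (sq_nonneg _), ← ENNReal.ofReal_ofNat 2,
    ← ENNReal.ofReal_mul (by norm_num)]
  refine ENNReal.ofReal_le_ofReal ?_
  nlinarith [sq_nonneg (b - a + (b - c))]

/-- The coefficient of the `i`-th term of an elementary process stopped at time `t`. -/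
noncomputable def ElementaryProcess.stoppedCoef (S : ElementaryProcess 𝓕)
    (t : Set.Icc (0 : ℝ) T) (i : Fin S.n) (ω : Ω) : ℝ :=
  if S.left i ≤ t then S.coef i ω else 0

/-- A term starting after `t` has zero stopped increment, but its coefficient need not be known at
the stopped left endpoint `t`; replacing it by zero restores adaptedness without changing the
integral. -/
theorem ElementaryProcess.stronglyMeasurable_stoppedCoef (S : ElementaryProcess 𝓕)
    (t : Set.Icc (0 : ℝ) T) (i : Fin S.n) :
    StronglyMeasurable[𝓕 (min (S.left i) t)] (S.stoppedCoef t i) := by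
  by_cases h : S.left i ≤ t
  · have : S.stoppedCoef t i = S.coef i := funext fun ω => if_pos h
    rw [this, min_eq_left h]
    exact S.coef_meas i
  · have : S.stoppedCoef t i = fun _ => 0 := funext fun ω => if_neg h
    rw [this]
    exact stronglyMeasurable_const

theorem ElementaryProcess.integral_eq_sum_stoppedCoef (S : ElementaryProcess 𝓕)
    (t : Set.Icc (0 : ℝ) T) (ω : Ω) : S.integral B t ω =
      ∑ i, S.stoppedCoef t i ω * (B (min (S.right i) t) ω - B (min (S.left i) t) ω) := by
  refine Finset.sum_congr rfl fun i _ => ?_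
  unfold ElementaryProcess.stoppedCoef
  split_ifs with h
  · rfl
  · have h' := (not_le.1 h).le
    rw [min_eq_right h', min_eq_right (h'.trans (S.left_le_right i)), sub_self, mul_zero, mul_zero]

theorem ElementaryProcess.val_eq_sum_stoppedCoef (S : ElementaryProcess 𝓕)
    {s t : Set.Icc (0 : ℝ) T} (hs : s ≤ t) (ω : Ω) : S.val s ω =
      ∑ i, (Set.Ioc (min (S.left i) t) (min (S.right i) t)).indicator
        (fun _ => S.stoppedCoef t i ω) s := by
  refine Finset.sum_congr rfl fun i _ => ?_
  unfold ElementaryProcess.stoppedCoef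
  by_cases h : S.left i ≤ t
  · have : s ∈ Set.Ioc (S.left i) (S.right i) ↔
        s ∈ Set.Ioc (min (S.left i) t) (min (S.right i) t) := by
      simp [min_eq_left h, hs]
    simp only [Set.indicator, this, if_pos h]
  · rw [if_neg h, Set.indicator_of_notMem fun hm => h (hm.1.le.trans hs), Set.indicator_apply,
      ite_self]

theorem ElementaryProcess.stronglyMeasurable_integral (S : ElementaryProcess 𝓕)
    (hB : IsFBrownianMotion 𝓕 P B) (t : Set.Icc (0 : ℝ) T) :
    StronglyMeasurable (S.integral B t) := by
  unfold ElementaryProcess.integral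
  refine Finset.stronglyMeasurable_fun_sum _ fun i _ => ?_
  exact ((S.coef_meas i).mono (𝓕.le _)).mul
    (((hB.adapted _).mono (𝓕.le _)).sub ((hB.adapted _).mono (𝓕.le _)))

/-- The elementary process `σ 1_{(u, v]}`. -/
def ElementaryProcess.const (𝓕 : Filtration (Set.Icc (0 : ℝ) T) mΩ) {u v : Set.Icc (0 : ℝ) T}
    (h : u ≤ v) (σ : ℝ) : ElementaryProcess 𝓕 where
  n := 1
  left _ := u
  right _ := v
  left_le_right _ := h
  coef _ _ := σ
  coef_meas _ := stronglyMeasurable_const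
  coef_bdd _ := ⟨|σ|, fun _ => le_rfl⟩

theorem ElementaryProcess.const_val {u v : Set.Icc (0 : ℝ) T} (h : u ≤ v) (σ : ℝ)
    (s : Set.Icc (0 : ℝ) T) (ω : Ω) :
    (ElementaryProcess.const 𝓕 h σ).val s ω = (Set.Ioc u v).indicator (fun _ => σ) s :=
  Fin.sum_univ_one _

theorem ElementaryProcess.const_integral {u v : Set.Icc (0 : ℝ) T} (h : u ≤ v) (σ : ℝ)
    (t : Set.Icc (0 : ℝ) T) (ω : Ω) :
    (ElementaryProcess.const 𝓕 h σ).integral B t ω = σ * (B (min v t) ω - B (min u t) ω) :=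
  Fin.sum_univ_one _

/-- The `L²` distance of an elementary integral from `σ (B t - B 0)` is at most the `L²` distance
of the elementary process from `σ 1_{s < t}`. -/
theorem ElementaryProcess.lintegral_integral_sub_le (S : ElementaryProcess 𝓕) [IsFiniteMeasure P]
    (hB : IsFBrownianMotion 𝓕 P B) {o : Set.Icc (0 : ℝ) T} (ho : (o : ℝ) = 0)
    (t : Set.Icc (0 : ℝ) T) (σ : ℝ) :
    ∫⁻ ω, ‖S.integral B t ω - σ * (B t ω - B o ω)‖ₑ ^ 2 ∂P ≤
      ∫⁻ ω, ∫⁻ s in Set.Iic t, ‖S.val s ω - (if s < t then σ else 0)‖ₑ ^ 2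
        ∂timeMeasure T ∂P := by
  have hot : ∀ s : Set.Icc (0 : ℝ) T, o ≤ s := fun s => by
    rw [← Subtype.coe_le_coe, ho]; exact s.2.1
  -- The extra index `none` carries `-σ` on `(0, t]`, so the difference to be estimated is itself an
  -- elementary integral and the isometry applies to it directly.
  set l : Option (Fin S.n) → Set.Icc (0 : ℝ) T := fun i => i.elim o fun i => min (S.left i) t
  set r : Option (Fin S.n) → Set.Icc (0 : ℝ) T := fun i => i.elim t fun i => min (S.right i) t
  set c : Option (Fin S.n) → Ω → ℝ := fun i => i.elim (fun _ => -σ) fun i => S.stoppedCoef t i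
  have hiso := hB.ito_isometry (l := l) (r := r) (c := c)
    (by rintro (_ | i)
        · exact hot t
        · exact min_le_min_right t (S.left_le_right i))
    (by rintro (_ | i)
        · exact stronglyMeasurable_const
        · exact S.stronglyMeasurable_stoppedCoef t i)
    (by rintro (_ | i)
        · exact ⟨|σ|, fun ω => (abs_neg σ).le⟩
        · obtain ⟨C, hC⟩ := S.coef_bdd i
          refine ⟨C, fun ω => ?_⟩
          change |S.stoppedCoef t i ω| ≤ C
          unfold ElementaryProcess.stoppedCoef
          split_ifs
          · exact hC ω
          · rw [abs_zero]; exact (abs_nonneg _).trans (hC ω))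
  have hint : ∀ ω, S.integral B t ω - σ * (B t ω - B o ω) =
      ∑ i, c i ω * (B (r i) ω - B (l i) ω) := by
    intro ω
    rw [Fintype.sum_option, S.integral_eq_sum_stoppedCoef]
    simp only [l, r, c, Option.elim]
    ring
  simp_rw [hint]
  rw [hiso]
  refine lintegral_mono fun ω => ?_
  rw [← lintegral_indicator measurableSet_Iic]
  refine lintegral_mono_ae ?_
  -- On `[0, t]` the indicators of `(0, t]` and of `s < t` differ only at the two endpoints.
  filter_upwards [ae_ne_timeMeasure o, ae_ne_timeMeasure t] with s hso hst
  rw [Fintype.sum_option]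
  by_cases hs : s ≤ t
  · rw [Set.indicator_of_mem (Set.mem_Iic.2 hs), S.val_eq_sum_stoppedCoef hs,
      if_pos (lt_of_le_of_ne hs hst)]
    have : s ∈ Set.Ioc o t := ⟨lt_of_le_of_ne (hot s) hso.symm, hs⟩
    simp only [l, r, c, Option.elim, Set.indicator_of_mem this]
    rw [neg_add_eq_sub]
  · have h0 : ∀ i, (Set.Ioc (l i) (r i)).indicator (fun _ => c i ω) s = 0 := by
      intro i
      refine Set.indicator_of_notMem (fun hm => hs (hm.2.trans ?_)) _
      rcases i with _ | i
      · exact le_rfl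
      · exact min_le_right _ _
    simp [h0]

/-- The elementary integrals converge in `L²` to `I` by definition and to `σ (B_t - B_0)` by the
isometry estimate, so the two limits coincide. -/
theorem IsItoIntegral.ae_eq_const_mul_increment [IsFiniteMeasure P]
    (hB : IsFBrownianMotion 𝓕 P B) {o : Set.Icc (0 : ℝ) T} (ho : (o : ℝ) = 0)
    {t : Set.Icc (0 : ℝ) T} {σ : ℝ} {I : Ω → ℝ}
    (hI : IsItoIntegral 𝓕 P B t (fun s _ => if s < t then σ else 0) I) :
    I =ᵐ[P] fun ω => σ * (B t ω - B o ω) := by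
  obtain ⟨S, hS1, hS2⟩ := hI.approx
  have hBm : ∀ s, AEMeasurable (B s) P := fun s =>
    ((hB.adapted s).mono (𝓕.le s)).measurable.aemeasurable
  have hIm : AEMeasurable I P := hI.memLp.1.aemeasurable
  have hle : ∀ k, ∫⁻ ω, ‖I ω - σ * (B t ω - B o ω)‖ₑ ^ 2 ∂P ≤
      2 * ((∫⁻ ω, ‖(S k).integral B t ω - I ω‖ₑ ^ 2 ∂P) +
        ∫⁻ ω, ∫⁻ s in Set.Iic t, ‖(S k).val s ω - (if s < t then σ else 0)‖ₑ ^ 2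
          ∂timeMeasure T ∂P) := by
    intro k
    have hm := ((S k).stronglyMeasurable_integral hB t).measurable.aemeasurable (μ := P)
    calc ∫⁻ ω, ‖I ω - σ * (B t ω - B o ω)‖ₑ ^ 2 ∂P
        ≤ ∫⁻ ω, 2 * (‖(S k).integral B t ω - I ω‖ₑ ^ 2 +
            ‖(S k).integral B t ω - σ * (B t ω - B o ω)‖ₑ ^ 2) ∂P :=
          lintegral_mono fun ω => enorm_sub_sq_le _ _ _
      _ = 2 * ((∫⁻ ω, ‖(S k).integral B t ω - I ω‖ₑ ^ 2 ∂P) +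
            ∫⁻ ω, ‖(S k).integral B t ω - σ * (B t ω - B o ω)‖ₑ ^ 2 ∂P) := by
          rw [lintegral_const_mul' _ _ (by norm_num),
            lintegral_add_left' ((hm.fun_sub hIm).enorm.pow_const 2)]
      _ ≤ _ := by
          refine mul_le_mul_right (add_le_add_right ?_ _) 2
          exact (S k).lintegral_integral_sub_le hB ho t σ
  have hlim := ENNReal.Tendsto.const_mul (hS2.add hS1) (Or.inr (by norm_num : (2 : ℝ≥0∞) ≠ ∞))
  rw [add_zero, mul_zero] at hlim
  have h0 := le_antisymm (ge_of_tendsto' hlim hle) zero_le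
  rw [lintegral_eq_zero_iff' ((hIm.fun_sub (((hBm t).fun_sub (hBm o)).const_mul σ)).enorm.pow_const 2)]
    at h0
  filter_upwards [h0] with ω hω
  simpa [sub_eq_zero] using hω

theorem isItoIntegral_const_mul_increment [IsProbabilityMeasure P]
    (hB : IsFBrownianMotion 𝓕 P B) {o : Set.Icc (0 : ℝ) T} (ho : (o : ℝ) = 0)
    (t : Set.Icc (0 : ℝ) T) (σ : ℝ) :
    IsItoIntegral 𝓕 P B t (fun s _ => if s < t then σ else 0)
      (fun ω => σ * (B t ω - B o ω)) := by
  have hot : ∀ s : Set.Icc (0 : ℝ) T, o ≤ s := fun s => by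
    rw [← Subtype.coe_le_coe, ho]; exact s.2.1
  refine ⟨fun i => ?_, ?_, (hB.memLp_increment (hot t)).const_mul σ, ?_⟩
  · refine Measurable.stronglyMeasurable (Measurable.ite ?_ measurable_const measurable_const)
    exact (measurable_subtype_coe.comp measurable_fst) measurableSet_Iio
  · have h : ∀ s : Set.Icc (0 : ℝ) T, ‖if s < t then σ else 0‖ₑ ^ 2 ≤ ‖σ‖ₑ ^ 2 := fun s => by
      split_ifs
      · exact le_rfl
      · simp
    refine lt_of_le_of_lt (lintegral_mono fun ω => lintegral_mono fun s => h s) ?_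
    simp only [lintegral_const, measure_univ, mul_one]
    exact ENNReal.mul_lt_top (ENNReal.pow_lt_top enorm_lt_top) (measure_lt_top _ _)
  -- A constant sequence suffices: `σ 1_{(0, t]}` already equals the integrand for almost every time
  -- in `[0, t]`.
  · refine ⟨fun _ => ElementaryProcess.const 𝓕 (hot t) σ, ?_, ?_⟩
    · have h : ∀ ω, ∫⁻ s in Set.Iic t, ‖(ElementaryProcess.const 𝓕 (hot t) σ).val s ω -
          (if s < t then σ else 0)‖ₑ ^ 2 ∂timeMeasure T = 0 := by
        intro ω
        refine (lintegral_congr_ae ?_).trans lintegral_zero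
        filter_upwards [ae_restrict_mem measurableSet_Iic,
          ae_restrict_of_ae (ae_ne_timeMeasure o), ae_restrict_of_ae (ae_ne_timeMeasure t)]
          with s hs hso hst
        have h1 : s ∈ Set.Ioc o t := ⟨lt_of_le_of_ne (hot s) hso.symm, hs⟩
        rw [ElementaryProcess.const_val, Set.indicator_of_mem h1,
          if_pos (lt_of_le_of_ne hs hst)]
        simp
      simp [h]
    · simp [ElementaryProcess.const_integral, min_eq_left (hot t)]

/-! ### The mild solution -/

/-- Mass one gives `σ` for `s < t`. The inequality is strict because the kernel is extended by zero
to time `0`. -/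
theorem integral_fundSol_mul_const {a₁ a₂ : ℝ} (h₁ : 0 < a₁) (h₂ : 0 < a₂) (ρ₁ ρ₂ σ : ℝ)
    (s t : Set.Icc (0 : ℝ) T) (x : ℝ) :
    ∫ z, fundSol a₁ a₂ ρ₁ ρ₂ ((t : ℝ) - s) x z * σ = if s < t then σ else 0 := by
  split_ifs with h
  · rw [integral_mul_const, integral_fundSol h₁ h₂ ρ₁ ρ₂ (sub_pos.2 h), one_mul]
  · have : (t : ℝ) - s ≤ 0 := sub_nonpos.2 (not_lt.1 h)
    simp [fundSol_of_nonpos a₁ a₂ ρ₁ ρ₂ this]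

/-- Every mild solution of the equation with additive noise is given by the explicit formula. -/
theorem IsMildSolution.ae_eq [IsFiniteMeasure P] (hB : IsFBrownianMotion 𝓕 P B)
    {o : Set.Icc (0 : ℝ) T} (ho : (o : ℝ) = 0) {a₁ a₂ ρ₁ ρ₂ : ℝ} (ha₁ : 0 < a₁) (ha₂ : 0 < a₂)
    {σ : ℝ} {ξ : ℝ → ℝ} {Y : Set.Icc (0 : ℝ) T → ℝ → Ω → ℝ}
    (hY : IsMildSolution (fundSol a₁ a₂ ρ₁ ρ₂) 𝓕 P B (fun _ _ _ _ => 0) (fun _ _ _ _ => σ) ξ Y)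
    {t : Set.Icc (0 : ℝ) T} (ht : 0 < (t : ℝ)) (x : ℝ) :
    Y t x =ᵐ[P] fun ω =>
      (∫ z, fundSol a₁ a₂ ρ₁ ρ₂ t x z * ξ z) + σ * (B t ω - B o ω) := by
  obtain ⟨I, hI, hYI⟩ := hY.mild t x ht
  simp_rw [integral_fundSol_mul_const ha₁ ha₂] at hI
  filter_upwards [hYI, hI.ae_eq_const_mul_increment hB ho] with ω h1 h2
  rw [h1, h2]
  simp

/-- Time `0` is treated separately because the kernel vanishes there and the formula would return
`0` instead of `ξ x`. -/
theorem isMildSolution_explicit [IsProbabilityMeasure P] (hB : IsFBrownianMotion 𝓕 P B)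
    {o : Set.Icc (0 : ℝ) T} (ho : (o : ℝ) = 0) {a₁ a₂ : ℝ} (ha₁ : 0 < a₁) (ha₂ : 0 < a₂)
    (ρ₁ ρ₂ σ : ℝ) {ξ : ℝ → ℝ} (hξ : Measurable ξ) {M : ℝ} (hM : ∀ x, |ξ x| ≤ M) :
    IsMildSolution (fundSol a₁ a₂ ρ₁ ρ₂) 𝓕 P B (fun _ _ _ _ => 0) (fun _ _ _ _ => σ) ξ
      (fun t x ω => if (t : ℝ) = 0 then ξ x else
        (∫ z, fundSol a₁ a₂ ρ₁ ρ₂ t x z * ξ z) + σ * (B t ω - B o ω)) where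
  adapted t x := by
    have hot : o ≤ t := by rw [← Subtype.coe_le_coe, ho]; exact t.2.1
    split_ifs
    · exact stronglyMeasurable_const
    · exact stronglyMeasurable_const.add
        (((hB.adapted t).sub ((hB.adapted o).mono (𝓕.mono hot))).const_mul σ)
  initial t x ht := Eventually.of_forall fun ω => if_pos ht
  integrable_initial t x ht := (integrable_fundSol ha₁ ha₂ ρ₁ ρ₂ ht x).mul_bdd (c := M)
    hξ.aestronglyMeasurable (Eventually.of_forall hM)
  integrable_drift t x ht := by simp
  integrable_noise t x ht := by
    refine Eventually.of_forall fun s => Eventually.of_forall fun ω => ?_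
    rcases le_or_gt ((t : ℝ) - s) 0 with h | h
    · simp [fundSol_of_nonpos a₁ a₂ ρ₁ ρ₂ h]
    · exact (integrable_fundSol ha₁ ha₂ ρ₁ ρ₂ h x).mul_const σ
  mild t x ht := by
    refine ⟨fun ω => σ * (B t ω - B o ω), ?_, Eventually.of_forall fun ω => ?_⟩
    · simp_rw [integral_fundSol_mul_const ha₁ ha₂]
      exact isItoIntegral_const_mul_increment hB ho t σ
    · simp [ht.ne']

/-- The kernel is a probability density, so the deterministic part `m` satisfies `|m| ≤ M`. The
bound then follows from `(m + n)² ≤ 2 (m² + n²)` and the variance `t ≤ T` of the Brownian increment.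
-/
theorem IsMildSolution.lintegral_sq_le [IsProbabilityMeasure P] (hB : IsFBrownianMotion 𝓕 P B)
    {o : Set.Icc (0 : ℝ) T} (ho : (o : ℝ) = 0) {a₁ a₂ ρ₁ ρ₂ : ℝ} (ha₁ : 0 < a₁) (ha₂ : 0 < a₂)
    (hρ₁ : 0 < ρ₁) (hρ₂ : 0 < ρ₂) {σ : ℝ} {ξ : ℝ → ℝ} {M : ℝ} (hM : ∀ x, |ξ x| ≤ M)
    {Y : Set.Icc (0 : ℝ) T → ℝ → Ω → ℝ}
    (hY : IsMildSolution (fundSol a₁ a₂ ρ₁ ρ₂) 𝓕 P B (fun _ _ _ _ => 0) (fun _ _ _ _ => σ) ξ Y)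
    (t : Set.Icc (0 : ℝ) T) (x : ℝ) :
    ∫⁻ ω, ‖Y t x ω‖ₑ ^ 2 ∂P ≤ ENNReal.ofReal (2 * (M ^ 2 + σ ^ 2 * T)) := by
  have hsq : ∀ {y : ℝ}, |y| ≤ M → y ^ 2 ≤ M ^ 2 := fun h => by
    rw [← sq_abs]; exact pow_le_pow_left₀ (abs_nonneg _) h 2
  have hσT : 0 ≤ σ ^ 2 * T := mul_nonneg (sq_nonneg σ) (t.2.1.trans t.2.2)
  rcases t.2.1.eq_or_lt with ht | ht
  · have h : ∀ᵐ ω ∂P, ‖Y t x ω‖ₑ ^ 2 ≤ ENNReal.ofReal (2 * (M ^ 2 + σ ^ 2 * T)) := by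
      filter_upwards [hY.initial t x ht.symm] with ω hω
      rw [hω, enorm_sq_eq_ofReal]
      refine ENNReal.ofReal_le_ofReal ?_
      nlinarith [hsq (hM x), sq_nonneg M]
    refine (lintegral_mono_ae h).trans ?_
    simp
  · have hot : o ≤ t := by rw [← Subtype.coe_le_coe, ho]; exact t.2.1
    set m := ∫ z, fundSol a₁ a₂ ρ₁ ρ₂ t x z * ξ z with hm
    have hmM : m ^ 2 ≤ M ^ 2 := hsq (abs_integral_fundSol_mul_le ha₁ ha₂ hρ₁ hρ₂ ht x hM)
    have hi := (hB.memLp_increment hot).integrable_sq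
    have hi' : Integrable (fun ω => 2 * (m ^ 2 + σ ^ 2 * (B t ω - B o ω) ^ 2)) P :=
      ((integrable_const _).fun_add (hi.const_mul _)).const_mul 2
    calc ∫⁻ ω, ‖Y t x ω‖ₑ ^ 2 ∂P
        ≤ ∫⁻ ω, ENNReal.ofReal (2 * (m ^ 2 + σ ^ 2 * (B t ω - B o ω) ^ 2)) ∂P := by
          refine lintegral_mono_ae ?_
          filter_upwards [hY.ae_eq hB ho ha₁ ha₂ ht x] with ω hω
          rw [hω, enorm_sq_eq_ofReal]
          refine ENNReal.ofReal_le_ofReal ?_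
          nlinarith [sq_nonneg (m - σ * (B t ω - B o ω))]
      _ = ENNReal.ofReal (∫ ω, 2 * (m ^ 2 + σ ^ 2 * (B t ω - B o ω) ^ 2) ∂P) :=
          (ofReal_integral_eq_lintegral_ofReal hi'
            (Eventually.of_forall fun ω => by positivity)).symm
      _ ≤ _ := by
          refine ENNReal.ofReal_le_ofReal ?_
          rw [integral_const_mul, integral_add (integrable_const _) (hi.const_mul _),
            integral_const_mul, hB.integral_increment_sq hot, ho, sub_zero]
          simp only [integral_const, probReal_univ, one_smul]
          have := mul_le_mul_of_nonneg_left t.2.2 (sq_nonneg σ)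
          linarith

end Stochastic

theorem mainTheorem2 {Ω : Type*} {mΩ : MeasurableSpace Ω} (P : Measure Ω) [IsProbabilityMeasure P]
    (T : ℝ) (hT : 0 < T)
    (𝓕 : Filtration (Set.Icc (0 : ℝ) T) mΩ) (h𝓕 : UsualConditions 𝓕 P)
    (B : Set.Icc (0 : ℝ) T → Ω → ℝ) (hB : IsFBrownianMotion 𝓕 P B)
    (a₁ a₂ ρ₁ ρ₂ : ℝ) (ha₁ : 0 < a₁) (ha₂ : 0 < a₂) (hρ₁ : 0 < ρ₁) (hρ₂ : 0 < ρ₂)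
    (σ₀ : ℝ) (ξ : ℝ → ℝ) (hξ : Measurable ξ) (hξb : ∃ M : ℝ, ∀ x, |ξ x| ≤ M) :
    IsFundamentalSolution a₁ a₂ ρ₁ ρ₂ (fundSol a₁ a₂ ρ₁ ρ₂) ∧
    (∃ Y : Set.Icc (0 : ℝ) T → ℝ → Ω → ℝ,
      IsMildSolution (fundSol a₁ a₂ ρ₁ ρ₂) 𝓕 P B (fun _ _ _ _ => 0) (fun _ _ _ _ => σ₀) ξ Y) ∧
    (∀ Y Y' : Set.Icc (0 : ℝ) T → ℝ → Ω → ℝ,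
      IsMildSolution (fundSol a₁ a₂ ρ₁ ρ₂) 𝓕 P B (fun _ _ _ _ => 0) (fun _ _ _ _ => σ₀) ξ Y →
      IsMildSolution (fundSol a₁ a₂ ρ₁ ρ₂) 𝓕 P B (fun _ _ _ _ => 0) (fun _ _ _ _ => σ₀) ξ Y' →
      ∀ t x, Y t x =ᵐ[P] Y' t x) ∧
    (∀ Y : Set.Icc (0 : ℝ) T → ℝ → Ω → ℝ,
      IsMildSolution (fundSol a₁ a₂ ρ₁ ρ₂) 𝓕 P B (fun _ _ _ _ => 0) (fun _ _ _ _ => σ₀) ξ Y →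
      (⨆ t : Set.Icc (0 : ℝ) T, ⨆ x : ℝ, ∫⁻ ω, ‖Y t x ω‖ₑ ^ 2 ∂P) < ∞) := by
  obtain ⟨M, hM⟩ := hξb
  have ho : ((⟨0, le_rfl, hT.le⟩ : Set.Icc (0 : ℝ) T) : ℝ) = 0 := rfl
  refine ⟨isFundamentalSolution_fundSol ha₁ ha₂ hρ₁ hρ₂,
    ⟨_, isMildSolution_explicit hB ho ha₁ ha₂ ρ₁ ρ₂ σ₀ hξ hM⟩, ?_, ?_⟩
  · intro Y Y' hY hY' t x
    rcases t.2.1.eq_or_lt with ht | ht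
    · filter_upwards [hY.initial t x ht.symm, hY'.initial t x ht.symm] with ω h h'
      rw [h, h']
    · exact (hY.ae_eq hB ho ha₁ ha₂ ht x).trans (hY'.ae_eq hB ho ha₁ ha₂ ht x).symm
  · intro Y hY
    exact lt_of_le_of_lt (iSup_le fun t => iSup_le fun x =>
      hY.lintegral_sq_le hB ho ha₁ ha₂ hρ₁ hρ₂ hM t x) ENNReal.ofReal_lt_top
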